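/- **Theorem 1.2.** For every sequence $(a_n)_{n\ge 1}$ of nonnegative real numbers with $a_n\to 0$ there exist a stationary, ergodic, irreducible and aperiodic Markov chain $(Y_k)_{k\ge 0}$ with a countable state space $E$ and a function $g:E\to\mathbb R$ such that the random variables $X_i=g(Y_i)$, $i\ge 0$, satisfy $E[X_i]=0$ and $E[X_i^2]<\infty$, and such that, with $S_n=\sum_{i=1}^n X_i$ and $\|Z\|=\sqrt{E[Z^2]}$, $$\sum_{n=1}^{\infty} a_n\,\frac{\|E(S_n\mid Y_0)\|}{n^{3/2}}<\infty ,$$ but the sequence $(S_n/\sqrt n)_{n\ge1}$ is not stochastically bounded, that is, it is not true that for every $\varepsilon>0$ there is an $M$ with $P(|S_n|/\sqrt n>M)\le\varepsilon$ for all $n\ge 1$. Here "ergodic" means that every shift-invariant event of the path space $E^{\mathbb N}$ has probability $0$ or $1$ under the law of $(Y_k)_{k\ge0}$. (So the condition $\sum_{n\ge1}\|E(S_n\mid Y_0)\|/n^{3/2}<\infty$, which is known to imply the invariance principle for stationary sequences, is optimal in this sense.) -/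

import Mathlib

open MeasureTheory ProbabilityTheory Filter Topology

namespace StationaryChain

/-- The process `Y` on `(Ω, μ)` is a (time-homogeneous, discrete time) Markov chain on the countable
state space `E` with transition probabilities `P i j`: for all states `x₀, …, xₙ, j`,
`μ(Y₀ = x₀, …, Yₙ = xₙ, Yₙ₊₁ = j) = μ(Y₀ = x₀, …, Yₙ = xₙ) * P xₙ j`. -/
structure IsMarkovChain {Ω E : Type*} [MeasurableSpace Ω] [MeasurableSpace E]
    (P : E → PMF E) (Y : ℕ → Ω → E) (μ : Measure Ω) : Prop where
  measurable : ∀ n, Measurable (Y n)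
  transition : ∀ (n : ℕ) (x : ℕ → E) (j : E),
    μ {ω | (∀ k ≤ n, Y k ω = x k) ∧ Y (n + 1) ω = j}
      = μ {ω | ∀ k ≤ n, Y k ω = x k} * P (x n) j

/-- The law of `n` steps of the chain with transition probabilities `P`, started at `i`. -/
noncomputable def nStep {E : Type*} (P : E → PMF E) : ℕ → E → PMF E
  | 0, i => PMF.pure i
  | n + 1, i => (nStep P n i).bind P

/-- Every state can be reached from every state. -/
def IsIrreducible {E : Type*} (P : E → PMF E) : Prop :=
  ∀ i j : E, ∃ n : ℕ, nStep P n i j ≠ 0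

/-- For every state `i`, the greatest common divisor of the possible return times to `i` is `1`. -/
def IsAperiodic {E : Type*} (P : E → PMF E) : Prop :=
  ∀ (i : E) (d : ℕ), (∀ n : ℕ, 1 ≤ n → nStep P n i i ≠ 0 → d ∣ n) → d = 1

/-- The left shift `(x₀, x₁, …) ↦ (x₁, x₂, …)` on the path space. -/
def pathShift {E : Type*} (x : ℕ → E) : ℕ → E := fun n => x (n + 1)

/-- The law of the process `Y` on the path space. -/
noncomputable def pathLaw {Ω E : Type*} [MeasurableSpace Ω] [MeasurableSpace E]
    (Y : ℕ → Ω → E) (μ : Measure Ω) : Measure (ℕ → E) :=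
  μ.map (fun ω n => Y n ω)

/-- The process is (strictly) stationary: its law is invariant under the shift. -/
def IsStationaryProcess {Ω E : Type*} [MeasurableSpace Ω] [MeasurableSpace E]
    (Y : ℕ → Ω → E) (μ : Measure Ω) : Prop :=
  MeasurePreserving (pathShift (E := E)) (pathLaw Y μ) (pathLaw Y μ)

/-- The stationary process is ergodic: every shift-invariant event has probability `0` or `1`. -/
def IsErgodicProcess {Ω E : Type*} [MeasurableSpace Ω] [MeasurableSpace E]
    (Y : ℕ → Ω → E) (μ : Measure Ω) : Prop :=
  Ergodic (pathShift (E := E)) (pathLaw Y μ)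

/-- The partial sum `Sₙ = g(Y₁) + ⋯ + g(Yₙ)`. -/
def partialSum {Ω E : Type*} (g : E → ℝ) (Y : ℕ → Ω → E) (n : ℕ) (ω : Ω) : ℝ :=
  ∑ i ∈ Finset.Icc 1 n, g (Y i ω)

/-- `‖Z‖ = √(E[Z²])`, used for square-integrable `Z`. -/
noncomputable def l2Norm {Ω : Type*} [MeasurableSpace Ω] (μ : Measure Ω) (Z : Ω → ℝ) : ℝ :=
  √(∫ ω, (Z ω) ^ 2 ∂μ)

/-- The sequence `Z₀, Z₁, …` is stochastically bounded (bounded in probability):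
for every `ε > 0` there is `M` with `μ(|Zₙ| > M) ≤ ε` for all `n`. -/
def StochasticallyBounded {Ω : Type*} [MeasurableSpace Ω] (μ : Measure Ω) (Z : ℕ → Ω → ℝ) : Prop :=
  ∀ ε : ℝ, 0 < ε → ∃ M : ℝ, ∀ n : ℕ, μ {ω | M < |Z n ω|} ≤ ENNReal.ofReal ε

end StationaryChain

/-! The chain consists of loops at $0$: from $0$ it jumps to $x$ with a symmetric law $q$, then
walks back one unit at a time, and the functional is the sign. A complete loop adds its jump $x$ to
$S_n$. After the first visit to $0$ the future is symmetric, so $E(S_n\mid Y_0)$ sees only the rest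
of the current loop and is at most $\min(n,|Y_0|)$ in absolute value. The invariant law is the
normalized occupation measure of a loop, whence $\|E(S_n\mid Y_0)\|^2\le\int|m|\min(n,|m|)^2\,dq$
(`sq_l2Norm_condExp_le`).

Let $q$ charge $\pm v_k$ with total mass $p_k=(2\rho_k)^{-2}$, where $v_k=2^k\cdot2\rho_k$, so that
$p_kv_k=4^k/v_k$. The norm is then at most $\sum_k2^k\min(n,v_k)/\sqrt{v_k}$. The weights
$\min(n,v)/(\sqrt v\,n^{3/2})$ have sum at most $4$ over $n$ and are each at most $1/\sqrt v$. As
$a_n\to0$, their $a$-weighted sum vanishes as $v\to\infty$ (`eventually_sum_mul_kernelWeight_le`).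
Sparse $\rho_k$ make it at most $4^{-k}$ at scale $k$, and the series is at most $\sum_k2^{-k}=2$.

For $n=(2\rho_k)^2$, however, $v_k=2^k\sqrt n$, and a loop of length $v_k$ starts before time
$\rho_k^2=n/4$ with probability bounded below uniformly in $k$. Reversing its jump preserves the law
and changes $S_n$ by $2v_k$, so one of the two paths has $|S_n|\ge v_k$ (`measure_firstJump_le`,
`le_measure_partialSum`). Hence $P(|S_n|\ge2^k\sqrt n)\ge1/32$ for every $k$. -/

namespace LoopChain

/-! ### Independent innovations -/

/-- The shifted sequence `(uₙ, uₙ₊₁, …)`. -/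
def seqTail (n : ℕ) (u : ℕ → ℤ) : ℕ → ℤ := fun i => u (i + n)

/-- The sequence with first term `p.1` followed by `p.2`. -/
def seqCons (p : ℤ × (ℕ → ℤ)) : ℕ → ℤ := fun n => Nat.casesOn n p.1 p.2

/-- The law of an independent sequence with common law `q`. -/
noncomputable def seqLaw (q : Measure ℤ) [IsProbabilityMeasure q] : Measure (ℕ → ℤ) :=
  Measure.infinitePi (fun _ : ℕ => q)

instance (q : Measure ℤ) [IsProbabilityMeasure q] : IsProbabilityMeasure (seqLaw q) := by
  unfold seqLaw; infer_instance

theorem measurable_seqTail (n : ℕ) : Measurable (seqTail n) := by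
  unfold seqTail; fun_prop

theorem measurable_seqCons : Measurable seqCons := by
  refine measurable_pi_lambda _ fun n => ?_
  cases n with
  | zero => exact measurable_fst
  | succ n => exact (measurable_pi_apply n).comp measurable_snd

theorem map_seqCons (q : Measure ℤ) [IsProbabilityMeasure q] :
    (q.prod (seqLaw q)).map seqCons = seqLaw q := by
  refine Measure.eq_infinitePi _ fun s t ht => ?_
  classical
  obtain ⟨N, hN⟩ : ∃ N, s ⊆ Finset.range (N + 1) :=
    ⟨s.sup id, fun i hi => Finset.mem_range.2 (Nat.lt_succ_of_le (Finset.le_sup (f := id) hi))⟩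
  -- Enlarging `s` to an initial segment, with trivial constraints at the new indices, lets the
  -- factor at `0` split off.
  let t' : ℕ → Set ℤ := fun i => if i ∈ s then t i else Set.univ
  have hpre : seqCons ⁻¹' (Set.pi (s : Set ℕ) t)
      = t' 0 ×ˢ Set.pi (Finset.range N : Set ℕ) (fun i => t' (i + 1)) := by
    ext ⟨x, u⟩
    simp only [Set.mem_preimage, Set.mem_pi, Set.mem_prod, t', Finset.mem_coe, Finset.mem_range]
    constructor
    · intro h
      refine ⟨?_, fun i _ => ?_⟩
      · split_ifs with h0
        · exact h 0 h0
        · trivial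
      · split_ifs with h0
        · exact h (i + 1) h0
        · trivial
    · rintro ⟨h0, h1⟩ i hi
      cases i with
      | zero => simpa [hi, seqCons] using h0
      | succ i =>
        have := h1 i (by have := Finset.mem_range.1 (hN hi); omega)
        simpa [hi, seqCons] using this
  rw [Measure.map_apply measurable_seqCons
    (MeasurableSet.pi s.countable_toSet fun i _ => ht i), hpre, Measure.prod_prod, seqLaw,
    Measure.infinitePi_pi _ (fun i _ => MeasurableSet.of_discrete),
    mul_comm, ← Finset.prod_range_succ' (fun i => q (t' i)),
    ← Finset.prod_subset hN (f := fun i => q (t' i))]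
  · exact Finset.prod_congr rfl fun i hi => by simp [t', hi]
  · intro i _ hi; simp [t', hi]

theorem seqLaw_apply (q : Measure ℤ) [IsProbabilityMeasure q] {G : Set (ℕ → ℤ)}
    (hG : MeasurableSet G) :
    seqLaw q G = ∫⁻ x, seqLaw q {u | seqCons (x, u) ∈ G} ∂q := by
  conv_lhs => rw [← map_seqCons q]
  rw [Measure.map_apply measurable_seqCons hG, Measure.prod_apply (measurable_seqCons hG)]
  rfl

/-- An event depending on the first `n` terms is independent of the terms from index `n` on. -/
theorem seqLaw_inter_tail (q : Measure ℤ) [IsProbabilityMeasure q] {D : Set (ℕ → ℤ)}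
    (hD : MeasurableSet D) (n : ℕ) {G : Set (ℕ → ℤ)} (hG : MeasurableSet G)
    (hdep : ∀ u v : ℕ → ℤ, (∀ i < n, u i = v i) → u ∈ G → v ∈ G) :
    seqLaw q (G ∩ seqTail n ⁻¹' D) = seqLaw q G * seqLaw q D := by
  induction n generalizing G with
  | zero =>
    have h0 : seqTail 0 ⁻¹' D = D := rfl
    rcases G.eq_empty_or_nonempty with rfl | ⟨u, hu⟩
    · simp
    · have : G = Set.univ := Set.eq_univ_of_forall fun v => hdep u v (by simp) hu
      rw [h0, this]; simp
  | succ n ih =>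
    -- Once the first term is fixed, the section of `G` depends on `n` terms only.
    rw [seqLaw_apply q (hG.inter (measurable_seqTail _ hD)), seqLaw_apply q hG,
      ← lintegral_mul_const _ (measurable_of_countable _)]
    refine lintegral_congr fun x => ?_
    refine ih (G := {u | seqCons (x, u) ∈ G}) ?_ fun u v huv hu => ?_
    · exact (measurable_seqCons.comp measurable_prodMk_left) hG
    · refine hdep _ _ (fun i hi => ?_) hu
      cases i with
      | zero => rfl
      | succ i => exact huv i (by omega)

theorem seqLaw_eval (q : Measure ℤ) [IsProbabilityMeasure q] (n : ℕ) (s : Set ℤ) :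
    seqLaw q {u | u n ∈ s} = q s :=
  (measurePreserving_eval_infinitePi (fun _ : ℕ => q) n).measure_preimage
    (MeasurableSet.of_discrete (s := s)).nullMeasurableSet

theorem map_seqTail (q : Measure ℤ) [IsProbabilityMeasure q] (n : ℕ) :
    (seqLaw q).map (seqTail n) = seqLaw q := by
  ext D hD
  rw [Measure.map_apply (measurable_seqTail n) hD]
  simpa using seqLaw_inter_tail q hD n MeasurableSet.univ (fun _ _ _ _ => trivial)

theorem prod_inter_tail (π q : Measure ℤ) [IsProbabilityMeasure π] [IsProbabilityMeasure q]
    {D : Set (ℕ → ℤ)} (hD : MeasurableSet D) (n : ℕ) {B : Set (ℤ × (ℕ → ℤ))}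
    (hB : MeasurableSet B)
    (hdep : ∀ ω ω' : ℤ × (ℕ → ℤ), ω.1 = ω'.1 → (∀ i < n, ω.2 i = ω'.2 i) → ω ∈ B → ω' ∈ B) :
    π.prod (seqLaw q) (B ∩ {ω | seqTail n ω.2 ∈ D}) = π.prod (seqLaw q) B * seqLaw q D := by
  have hD' : MeasurableSet {ω : ℤ × (ℕ → ℤ) | seqTail n ω.2 ∈ D} :=
    ((measurable_seqTail n).comp measurable_snd) hD
  rw [Measure.prod_apply (hB.inter hD'), Measure.prod_apply hB,
    ← lintegral_mul_const _ (measurable_of_countable _)]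
  refine lintegral_congr fun x => ?_
  exact seqLaw_inter_tail q hD n (measurable_prodMk_left hB)
    fun u v huv hu => hdep (x, u) (x, v) rfl huv hu

/-- The sequence with the signs of the terms with index in `I` changed. -/
def flipOn (I : ℕ → Prop) [DecidablePred I] (u : ℕ → ℤ) : ℕ → ℤ :=
  fun i => if I i then -u i else u i

theorem measurePreserving_flipOn (q : Measure ℤ) [IsProbabilityMeasure q]
    (hq : q.map (fun m => -m) = q) (I : ℕ → Prop) [DecidablePred I] :
    MeasurePreserving (flipOn I) (seqLaw q) (seqLaw q) := by
  refine ⟨by unfold flipOn; exact measurable_pi_lambda _ fun i => by split_ifs <;> fun_prop, ?_⟩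
  have h := Measure.infinitePi_map_pi (fun _ : ℕ => q)
    (f := fun i m => if I i then -m else m) (fun i => measurable_of_countable _)
  refine (show _ = _ from h).trans ?_
  unfold seqLaw
  congr 1
  funext i
  by_cases hi : I i
  · simpa [hi] using hq
  · simp [hi]

/-! ### The chain: Markov property and stationarity -/

/-- One step of the chain: towards `0` by one unit, or from `0` to `x`. -/
def step (m x : ℤ) : ℤ := if m = 0 then x else m - m.sign

/-- The chain driven by the initial state `ω.1` and the innovations `ω.2`. -/
def chain : ℕ → ℤ × (ℕ → ℤ) → ℤ
  | 0, ω => ω.1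
  | n + 1, ω => step (chain n ω) (ω.2 n)

/-- The shift on the underlying space, with `chain (n + 1) ω = chain n (advance ω)`. -/
def advance (ω : ℤ × (ℕ → ℤ)) : ℤ × (ℕ → ℤ) := (step ω.1 (ω.2 0), seqTail 1 ω.2)

theorem measurable_chain (n : ℕ) : Measurable (chain n) := by
  induction n with
  | zero => exact measurable_fst
  | succ n ih =>
    have : Measurable (fun p : ℤ × ℤ => step p.1 p.2) := measurable_of_countable _
    exact this.comp (ih.prodMk ((measurable_pi_apply n).comp measurable_snd))

theorem measurable_advance : Measurable advance := by
  have : Measurable (fun p : ℤ × ℤ => step p.1 p.2) := measurable_of_countable _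
  exact (this.comp (measurable_fst.prodMk ((measurable_pi_apply 0).comp measurable_snd))).prodMk
    ((measurable_seqTail 1).comp measurable_snd)

theorem chain_advance (n : ℕ) (ω : ℤ × (ℕ → ℤ)) : chain n (advance ω) = chain (n + 1) ω := by
  induction n with
  | zero => rfl
  | succ n ih => rw [chain, ih]; rfl

theorem iterate_advance (n : ℕ) (ω : ℤ × (ℕ → ℤ)) :
    advance^[n] ω = (chain n ω, seqTail n ω.2) := by
  induction n generalizing ω with
  | zero => rfl
  | succ n ih =>
    rw [Function.iterate_succ_apply, ih, chain_advance]
    refine Prod.ext rfl (funext fun i => ?_)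
    simp only [advance, seqTail]
    congr 1

theorem chain_congr {ω ω' : ℤ × (ℕ → ℤ)} (n : ℕ) (h0 : ω.1 = ω'.1)
    (h : ∀ i < n, ω.2 i = ω'.2 i) : chain n ω = chain n ω' := by
  induction n with
  | zero => exact h0
  | succ n ih => rw [chain, chain, ih fun i hi => h i (by omega), h n (by omega)]

/-- A probability measure which is invariant under the transitions of the chain. -/
def IsInvariant (π q : Measure ℤ) : Prop :=
  (π.prod q).map (fun p => step p.1 p.2) = π

/-- A step consumes the first innovation. By invariance the new state has law `π`, and it is
independent of the remaining innovations. -/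
theorem measurePreserving_advance (π q : Measure ℤ) [IsProbabilityMeasure π]
    [IsProbabilityMeasure q] (h : IsInvariant π q) :
    MeasurePreserving advance (π.prod (seqLaw q)) (π.prod (seqLaw q)) := by
  refine ⟨measurable_advance, ?_⟩
  have hs : MeasurePreserving (fun p : ℤ × ℤ => step p.1 p.2) (π.prod q) π :=
    ⟨measurable_of_countable _, h⟩
  have e1 : MeasurePreserving (Prod.map (id : ℤ → ℤ) seqCons) (π.prod (q.prod (seqLaw q)))
      (π.prod (seqLaw q)) :=
    (MeasurePreserving.id π).prod ⟨measurable_seqCons, map_seqCons q⟩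
  have e2 := hs.prod (MeasurePreserving.id (seqLaw q))
  have e3 : MeasurePreserving MeasurableEquiv.prodAssoc ((π.prod q).prod (seqLaw q))
      (π.prod (q.prod (seqLaw q))) := measurePreserving_prodAssoc _ _ _
  have key : advance ∘ (Prod.map (id : ℤ → ℤ) seqCons) ∘ MeasurableEquiv.prodAssoc
      = Prod.map (fun p : ℤ × ℤ => step p.1 p.2) (id : (ℕ → ℤ) → ℕ → ℤ) := by
    funext ⟨⟨a, b⟩, u⟩; rfl
  have e4 := e1.comp e3
  rw [← e4.map_eq, Measure.map_map measurable_advance e4.measurable]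
  change Measure.map (advance ∘ (Prod.map (id : ℤ → ℤ) seqCons) ∘ MeasurableEquiv.prodAssoc) _ = _
  rw [key, e2.map_eq, e4.map_eq]

theorem measurePreserving_chain (π q : Measure ℤ) [IsProbabilityMeasure π]
    [IsProbabilityMeasure q] (h : IsInvariant π q) (n : ℕ) :
    MeasurePreserving (chain n) (π.prod (seqLaw q)) π := by
  have h1 := (measurePreserving_fst (μ := π) (ν := seqLaw q)).comp
    ((measurePreserving_advance π q h).iterate n)
  convert h1 using 1
  funext ω
  simp [iterate_advance]

/-- The transition probabilities of the chain. -/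
noncomputable def transition (q : Measure ℤ) [IsProbabilityMeasure q] (m : ℤ) : PMF ℤ :=
  haveI : IsProbabilityMeasure (q.map (step m)) :=
    Measure.isProbabilityMeasure_map (measurable_of_countable _).aemeasurable
  (q.map (step m)).toPMF

theorem transition_apply (q : Measure ℤ) [IsProbabilityMeasure q] (m j : ℤ) :
    transition q m j = q {x | step m x = j} := by
  unfold transition
  rw [Measure.toPMF_apply, Measure.map_apply (measurable_of_countable _) (measurableSet_singleton _)]
  rfl

theorem isMarkovChain (π q : Measure ℤ) [IsProbabilityMeasure π] [IsProbabilityMeasure q] :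
    StationaryChain.IsMarkovChain (transition q) chain (π.prod (seqLaw q)) where
  measurable := measurable_chain
  transition n x j := by
    have hm : MeasurableSet {ω | ∀ k ≤ n, chain k ω = x k} := by
      simp only [Set.ofPred_forall]
      exact MeasurableSet.iInter fun k => MeasurableSet.iInter fun _ =>
        measurable_chain k (measurableSet_singleton _)
    have hD : MeasurableSet {u : ℕ → ℤ | step (x n) (u 0) = j} :=
      ((measurable_of_countable (step (x n))).comp (measurable_pi_apply 0))
        (measurableSet_singleton j)
    have h := prod_inter_tail π q hD n hm
      (fun ω ω' h0 h1 h k hk => by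
        rw [← h k hk]
        exact (chain_congr k h0 fun i hi => h1 i (by omega)).symm)
    have h2 : seqLaw q {u | step (x n) (u 0) = j} = transition q (x n) j := by
      rw [transition_apply]; exact seqLaw_eval q 0 {y | step (x n) y = j}
    rw [← h2, ← h]
    congr 1
    ext ω
    simp only [Set.mem_ofPred_eq, Set.mem_inter_iff, seqTail, chain, Nat.zero_add]
    constructor
    · rintro ⟨a, b⟩; exact ⟨a, by rwa [← a n le_rfl]⟩
    · rintro ⟨a, b⟩; exact ⟨a, by rwa [a n le_rfl]⟩

theorem measurable_path : Measurable (fun (ω : ℤ × (ℕ → ℤ)) n => chain n ω) :=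
  measurable_pi_lambda _ measurable_chain

theorem path_semiconj : Function.Semiconj (fun (ω : ℤ × (ℕ → ℤ)) n => chain n ω)
    advance (StationaryChain.pathShift (E := ℤ)) := fun ω => by
  funext n; exact chain_advance n ω

theorem isStationaryProcess (π q : Measure ℤ) [IsProbabilityMeasure π] [IsProbabilityMeasure q]
    (h : IsInvariant π q) :
    StationaryChain.IsStationaryProcess (E := ℤ) chain (π.prod (seqLaw q)) := by
  have hs : Measurable (StationaryChain.pathShift (E := ℤ)) := by
    unfold StationaryChain.pathShift; fun_prop
  refine ⟨hs, ?_⟩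
  unfold StationaryChain.pathLaw
  rw [Measure.map_map hs measurable_path, ← path_semiconj.comp_eq,
    ← Measure.map_map measurable_path measurable_advance,
    (measurePreserving_advance π q h).map_eq]

/-! ### The walk back to zero, and ergodicity -/

theorem step_iterate_sign (m : ℤ) (n : ℕ) (hn : n ≤ m.natAbs) (ω : ℤ × (ℕ → ℤ)) (k : ℕ)
    (hk : chain k ω = m) : chain (k + n) ω = m - m.sign * n := by
  induction n with
  | zero => simpa using hk
  | succ n ih =>
    rw [← add_assoc, chain, ih (by omega), step]
    rcases lt_trichotomy m 0 with h | h | h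
    · rw [Int.sign_eq_neg_one_of_neg h, if_neg (by omega), Int.sign_eq_neg_one_of_neg (by omega)]
      push_cast; ring
    · omega
    · rw [Int.sign_eq_one_of_pos h, if_neg (by omega), Int.sign_eq_one_of_pos (by omega)]
      push_cast; ring

theorem preimage_iterate_eq_self {α : Type*} {f : α → α} {A : Set α} (h : f ⁻¹' A = A) (n : ℕ) :
    f^[n] ⁻¹' A = A := by
  induction n with
  | zero => rfl
  | succ n ih => rw [Function.iterate_succ, Set.preimage_comp, ih, h]

/-- From `m` the chain is at `0` after `|m|` steps whatever the innovations, so the section at `m`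
is the section at `0` read after discarding `|m|` of them. -/
theorem section_const (q : Measure ℤ) [IsProbabilityMeasure q] {A : Set (ℤ × (ℕ → ℤ))}
    (hA : MeasurableSet A) (hinv : advance ⁻¹' A = A) (m : ℤ) :
    seqLaw q {u | (m, u) ∈ A} = seqLaw q {u | (0, u) ∈ A} := by
  have h : {u | (m, u) ∈ A} = seqTail m.natAbs ⁻¹' {u | (0, u) ∈ A} := by
    ext u
    have h1 := preimage_iterate_eq_self hinv m.natAbs
    have h2 := step_iterate_sign m m.natAbs le_rfl (m, u) 0 rfl
    rw [zero_add, Int.sign_mul_natAbs, sub_self] at h2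
    rw [Set.mem_ofPred_eq, Set.mem_preimage, Set.mem_ofPred_eq]
    conv_lhs => rw [← h1, Set.mem_preimage, iterate_advance, h2]
  have h0 : MeasurableSet {u | ((0 : ℤ), u) ∈ A} := measurable_prodMk_left hA
  rw [h, ← Measure.map_apply (measurable_seqTail _) h0, map_seqTail]

theorem generateFrom_cylinders : (inferInstance : MeasurableSpace (ℤ × (ℕ → ℤ)))
    = MeasurableSpace.generateFrom {B | MeasurableSet B ∧ ∃ n : ℕ, ∀ ω ω' : ℤ × (ℕ → ℤ),
      ω.1 = ω'.1 → (∀ i < n, ω.2 i = ω'.2 i) → ω ∈ B → ω' ∈ B} := by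
  apply le_antisymm
  · refine sup_le ?_ ?_
    · rintro _ ⟨s, hs, rfl⟩
      refine MeasurableSpace.measurableSet_generateFrom ⟨measurable_fst hs, 0, ?_⟩
      intro ω ω' h _ h'
      simpa [← h] using h'
    · rw [← measurable_iff_comap_le, @measurable_pi_iff]
      intro i s hs
      refine MeasurableSpace.measurableSet_generateFrom
        ⟨((measurable_pi_apply i).comp measurable_snd) hs, i + 1, ?_⟩
      intro ω ω' _ h h'
      have := h i (by omega)
      simpa [← this] using h'
  · exact MeasurableSpace.generateFrom_le fun B hB => hB.1

/-- All sections of an invariant set `A` have the same probability `c`, so `A` keeps probability `c`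
given the initial state and any finite number of innovations. Thus `A` is independent of all
cylinders, hence of itself, and `c = c * c`. -/
theorem ergodic_advance (π q : Measure ℤ) [IsProbabilityMeasure π] [IsProbabilityMeasure q]
    (h : IsInvariant π q) : Ergodic advance (π.prod (seqLaw q)) := by
  refine ⟨measurePreserving_advance π q h, ⟨fun A hA hinv => ?_⟩⟩
  set μ := π.prod (seqLaw q) with hμ
  set c := seqLaw q {u | (0, u) ∈ A} with hc
  have hcyl : ∀ B : Set (ℤ × (ℕ → ℤ)), (MeasurableSet B ∧ ∃ n : ℕ, ∀ ω ω' : ℤ × (ℕ → ℤ),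
      ω.1 = ω'.1 → (∀ i < n, ω.2 i = ω'.2 i) → ω ∈ B → ω' ∈ B) → μ (A ∩ B) = c * μ B := by
    rintro B ⟨hB, n, hdep⟩
    have h1 := preimage_iterate_eq_self hinv n
    have hBy : ∀ y, MeasurableSet (B ∩ chain n ⁻¹' {y}) := fun y =>
      hB.inter (measurable_chain n (measurableSet_singleton y))
    have hDy : ∀ y : ℤ, MeasurableSet {u | (y, u) ∈ A} := fun y => measurable_prodMk_left hA
    have hDy' : ∀ y : ℤ, MeasurableSet {ω : ℤ × (ℕ → ℤ) | seqTail n ω.2 ∈ {u | (y, u) ∈ A}} :=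
      fun y => ((measurable_seqTail n).comp measurable_snd) (hDy y)
    have hAB : A ∩ B = ⋃ y : ℤ, (B ∩ chain n ⁻¹' {y}) ∩
        {ω | seqTail n ω.2 ∈ {u | (y, u) ∈ A}} := by
      ext ω
      conv_lhs => rw [← h1]
      simp only [Set.mem_inter_iff, Set.mem_preimage, iterate_advance, Set.mem_iUnion,
        Set.mem_singleton_iff, Set.mem_ofPred_eq]
      constructor
      · rintro ⟨a, b⟩; exact ⟨_, ⟨b, rfl⟩, a⟩
      · rintro ⟨y, ⟨b, rfl⟩, a⟩; exact ⟨a, b⟩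
    have hBu : B = ⋃ y : ℤ, B ∩ chain n ⁻¹' {y} := by
      ext ω; simp
    have hdisj : Pairwise (Function.onFun Disjoint fun y : ℤ => B ∩ chain n ⁻¹' {y}) := by
      intro y z hyz
      refine Set.disjoint_left.2 ?_
      rintro ω ⟨_, h1⟩ ⟨_, h2⟩
      exact hyz (h1.symm.trans h2)
    rw [hAB, measure_iUnion (fun y z hyz => (hdisj hyz).mono Set.inter_subset_left
      Set.inter_subset_left) fun y => (hBy y).inter (hDy' y)]
    conv_rhs => rw [hBu, measure_iUnion hdisj hBy, ← ENNReal.tsum_mul_left]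
    refine tsum_congr fun y => ?_
    rw [hμ, prod_inter_tail π q (hDy y) n (hBy y), section_const q hA hinv, mul_comm]
    rintro ω ω' h0 hi ⟨hb, hy⟩
    exact ⟨hdep _ _ h0 hi hb, by
      rw [Set.mem_preimage, ← chain_congr n h0 hi]; exact hy⟩
  have hmu : μ A = c := by
    simpa using hcyl Set.univ ⟨MeasurableSet.univ, 0, fun _ _ _ _ _ => trivial⟩
  have hext : μ.restrict A = c • μ := by
    have : IsFiniteMeasure (c • μ) := ⟨by simp [← hmu]⟩
    refine ext_of_generate_finite _ generateFrom_cylinders ?_ (fun B hB => ?_) ?_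
    · rintro B ⟨hB, n, hn⟩ B' ⟨hB', n', hn'⟩ _
      refine ⟨hB.inter hB', max n n', ?_⟩
      rintro ω ω' h0 hi ⟨h1, h2⟩
      exact ⟨hn _ _ h0 (fun i h => hi i (lt_max_of_lt_left h)) h1,
        hn' _ _ h0 (fun i h => hi i (lt_max_of_lt_right h)) h2⟩
    · rw [Measure.restrict_apply hB.1, Set.inter_comm, hcyl B hB]; rfl
    · simp [hmu]
  have hcc : c = c * c := by
    have := congrArg (fun m => m A) hext
    simpa [Measure.restrict_apply hA, hmu] using this
  have h01 : μ A = 0 ∨ μ A = 1 := by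
    have hfin : c ≠ ⊤ := by rw [← hmu]; exact measure_ne_top _ _
    rw [hmu]
    by_cases h0 : c = 0
    · exact Or.inl h0
    · right
      have : c * 1 = c * c := by rw [mul_one]; exact hcc
      exact ((ENNReal.mul_right_inj h0 hfin).1 this).symm
  rw [eventuallyConst_set]
  rcases h01 with h0 | h1
  · right
    exact (measure_eq_zero_iff_ae_notMem.1 h0).mono fun ω hω => by simpa using hω
  · left
    exact (prob_compl_eq_zero_iff hA).2 h1

theorem isErgodicProcess (π q : Measure ℤ) [IsProbabilityMeasure π] [IsProbabilityMeasure q]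
    (h : IsInvariant π q) :
    StationaryChain.IsErgodicProcess (E := ℤ) chain (π.prod (seqLaw q)) := by
  refine ⟨isStationaryProcess π q h, ?_⟩
  exact MeasurePreserving.preErgodic_of_preErgodic_semiconj
    (μ' := StationaryChain.pathLaw (E := ℤ) chain (π.prod (seqLaw q)))
    ⟨measurable_path, rfl⟩ (ergodic_advance π q h).toPreErgodic path_semiconj

/-! ### Irreducibility and aperiodicity -/

theorem nStep_succ_ne_zero {P : ℤ → PMF ℤ} {n : ℕ} {i j k : ℤ}
    (h1 : StationaryChain.nStep P n i j ≠ 0) (h2 : P j k ≠ 0) :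
    StationaryChain.nStep P (n + 1) i k ≠ 0 := by
  rw [StationaryChain.nStep, ← PMF.mem_support_iff, PMF.mem_support_bind_iff]
  exact ⟨j, h1, h2⟩

theorem nStep_add_ne_zero {P : ℤ → PMF ℤ} {n m : ℕ} {i j k : ℤ}
    (h1 : StationaryChain.nStep P n i j ≠ 0) (h2 : StationaryChain.nStep P m j k ≠ 0) :
    StationaryChain.nStep P (n + m) i k ≠ 0 := by
  induction m generalizing k with
  | zero =>
    have : k = j := by
      by_contra h
      exact h2 (by simp [StationaryChain.nStep, h])
    subst this; exact h1
  | succ m ih =>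
    rw [StationaryChain.nStep, ← PMF.mem_support_iff, PMF.mem_support_bind_iff] at h2
    obtain ⟨l, hl, hk⟩ := h2
    exact nStep_succ_ne_zero (ih hl) hk

theorem transition_zero (q : Measure ℤ) [IsProbabilityMeasure q] (j : ℤ) :
    transition q 0 j = q {j} := by
  rw [transition_apply]; congr 1

theorem transition_ne_zero (q : Measure ℤ) [IsProbabilityMeasure q] {m : ℤ} (hm : m ≠ 0) :
    transition q m (m - m.sign) ≠ 0 := by
  rw [transition_apply]; simp [step, hm]

theorem nStep_toward_zero (q : Measure ℤ) [IsProbabilityMeasure q] (m : ℤ) (n : ℕ)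
    (hn : n ≤ m.natAbs) :
    StationaryChain.nStep (transition q) n m (m - m.sign * n) ≠ 0 := by
  induction n with
  | zero => simp [StationaryChain.nStep]
  | succ n ih =>
    refine nStep_succ_ne_zero (ih (by omega)) ?_
    rcases lt_trichotomy m 0 with h | h | h
    · rw [Int.sign_eq_neg_one_of_neg h]
      convert transition_ne_zero q (m := m - -1 * n) (by omega) using 1
      rw [Int.sign_eq_neg_one_of_neg (by omega)]; push_cast; congr 1; ring
    · omega
    · rw [Int.sign_eq_one_of_pos h]
      convert transition_ne_zero q (m := m - 1 * n) (by omega) using 1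
      rw [Int.sign_eq_one_of_pos (by omega)]; push_cast; congr 1; ring

theorem nStep_to_zero (q : Measure ℤ) [IsProbabilityMeasure q] (m : ℤ) :
    StationaryChain.nStep (transition q) m.natAbs m 0 ≠ 0 := by
  have := nStep_toward_zero q m m.natAbs le_rfl
  rwa [Int.sign_mul_natAbs, sub_self] at this

/-- The innovation law charges `0` and arbitrarily distant points on both sides. -/
def Spread (q : Measure ℤ) : Prop :=
  q {0} ≠ 0 ∧ ∀ N : ℕ, ∃ v : ℕ, N ≤ v ∧ q {(v : ℤ)} ≠ 0 ∧ q {-(v : ℤ)} ≠ 0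

/-- Jump beyond `j` on its own side of `0`, then walk back to `j`. -/
theorem exists_nStep_from_zero (q : Measure ℤ) [IsProbabilityMeasure q] (h : Spread q) (j : ℤ) :
    ∃ n, StationaryChain.nStep (transition q) n 0 j ≠ 0 := by
  obtain ⟨v, hv, hp, hn⟩ := h.2 (j.natAbs + 1)
  have h1 : ∀ x : ℤ, q {x} ≠ 0 → StationaryChain.nStep (transition q) 1 0 x ≠ 0 := fun x hx =>
    nStep_succ_ne_zero (n := 0) (j := 0) (by simp [StationaryChain.nStep])
      (by rwa [transition_zero])
  rcases lt_or_ge j 0 with hj | hj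
  · have := nStep_add_ne_zero (h1 _ hn) (nStep_toward_zero q (-(v : ℤ)) (v - j.natAbs) (by omega))
    rw [Int.sign_eq_neg_one_of_neg (by omega)] at this
    refine ⟨1 + (v - j.natAbs), ?_⟩
    convert this using 2; omega
  · have := nStep_add_ne_zero (h1 _ hp) (nStep_toward_zero q (v : ℤ) (v - j.natAbs) (by omega))
    rw [Int.sign_eq_one_of_pos (by omega)] at this
    refine ⟨1 + (v - j.natAbs), ?_⟩
    convert this using 2; omega

theorem isIrreducible (q : Measure ℤ) [IsProbabilityMeasure q] (h : Spread q) :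
    StationaryChain.IsIrreducible (transition q) := fun i j => by
  obtain ⟨n, hn⟩ := exists_nStep_from_zero q h j
  exact ⟨_, nStep_add_ne_zero (nStep_to_zero q i) hn⟩

/-- Holding at `0` for one more step gives two return times that differ by `1`. -/
theorem isAperiodic (q : Measure ℤ) [IsProbabilityMeasure q] (h : Spread q) :
    StationaryChain.IsAperiodic (transition q) := fun i d hd => by
  obtain ⟨n, hn⟩ := exists_nStep_from_zero q h i
  have h0 : transition q 0 0 ≠ 0 := by rw [transition_zero]; exact h.1
  have h1 := nStep_succ_ne_zero (nStep_to_zero q i) h0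
  have h2 := nStep_add_ne_zero h1 hn
  have h3 := nStep_add_ne_zero (nStep_succ_ne_zero h1 h0) hn
  have d1 := hd _ (by omega) h2
  have d2 := hd _ (by omega) h3
  have := (Nat.dvd_sub d2 d1)
  rw [show i.natAbs + 1 + 1 + n - (i.natAbs + 1 + n) = 1 by omega] at this
  exact Nat.dvd_one.1 this

/-! ### The invariant law -/

/-- The mean return time of the chain to `0`. -/
noncomputable def meanReturn (q : Measure ℤ) : ENNReal := ∫⁻ m, ((m.natAbs : ENNReal) + 1) ∂q

/-- The invariant law: the normalized occupation measure of an excursion from `0`. -/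
noncomputable def invariantLaw (q : Measure ℤ) : Measure ℤ :=
  (meanReturn q)⁻¹ • q.bind fun m =>
    ∑ j ∈ Finset.range (m.natAbs + 1), Measure.dirac (m.sign * (j : ℤ))

theorem lintegral_invariantLaw (q : Measure ℤ) (h : ℤ → ENNReal) :
    ∫⁻ m, h m ∂(invariantLaw q)
      = (meanReturn q)⁻¹ * ∫⁻ m, ∑ j ∈ Finset.range (m.natAbs + 1), h (m.sign * (j : ℤ)) ∂q := by
  rw [invariantLaw, lintegral_smul_measure, Measure.lintegral_bind
    (measurable_of_countable _).aemeasurable (measurable_of_countable _).aemeasurable]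
  simp [lintegral_dirac]

theorem one_le_meanReturn (q : Measure ℤ) [IsProbabilityMeasure q] : 1 ≤ meanReturn q := by
  calc (1 : ENNReal) = ∫⁻ _, 1 ∂q := by simp
    _ ≤ meanReturn q := lintegral_mono fun m => le_add_self

theorem isProbabilityMeasure_invariantLaw (q : Measure ℤ) [IsProbabilityMeasure q]
    (hq : meanReturn q ≠ ⊤) : IsProbabilityMeasure (invariantLaw q) := by
  constructor
  rw [← lintegral_one, lintegral_invariantLaw]
  have : ∀ m : ℤ, ∑ j ∈ Finset.range (m.natAbs + 1), (1 : ENNReal) = (m.natAbs : ENNReal) + 1 := by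
    simp
  simp_rw [this]
  refine ENNReal.inv_mul_cancel ?_ hq
  exact (zero_lt_one.trans_le (one_le_meanReturn q)).ne'

/-- One step moves the nonzero points of a loop inwards and so loses the outermost one. The step
taken from `0` has law `q`, which restores it on average. -/
theorem isInvariant_invariantLaw (q : Measure ℤ) [IsProbabilityMeasure q]
    (hq : meanReturn q ≠ ⊤) : IsInvariant (invariantLaw q) q := by
  have := isProbabilityMeasure_invariantLaw q hq
  refine Measure.ext_of_lintegral _ fun h hh => ?_
  have hm : Measurable (fun p : ℤ × ℤ => step p.1 p.2) := measurable_of_countable _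
  rw [lintegral_map hh hm, lintegral_prod _ (measurable_of_countable _).aemeasurable,
    lintegral_invariantLaw, lintegral_invariantLaw]
  congr 1
  have h1 : ∀ m : ℤ, ∑ j ∈ Finset.range (m.natAbs + 1), ∫⁻ y, h (step (m.sign * (j : ℤ)) y) ∂q
      = ∑ j ∈ Finset.range m.natAbs, h (m.sign * (j : ℤ)) + ∫⁻ y, h y ∂q := fun m => by
    rw [Finset.sum_range_succ']
    congr 1
    · refine Finset.sum_congr rfl fun j hj => ?_
      have hm : m.sign * ((j + 1 : ℕ) : ℤ) ≠ 0 := by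
        have := Finset.mem_range.1 hj
        refine mul_ne_zero (fun h => ?_) (by omega)
        rw [Int.sign_eq_zero_iff_zero] at h
        simp [h] at this
      have hs : (m.sign * ((j + 1 : ℕ) : ℤ)).sign = m.sign := by
        rw [Int.sign_mul, Int.sign_sign, Int.sign_natCast_of_ne_zero (by omega), mul_one]
      simp only [step, hm, if_false, hs, lintegral_const, measure_univ, mul_one]
      congr 1; push_cast; ring
    · simp [step]
  simp_rw [h1, Finset.sum_range_succ, Int.sign_mul_natAbs]
  rw [lintegral_add_right _ measurable_const, lintegral_add_right _ hh]
  simp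

theorem invariantLaw_zero (q : Measure ℤ) [IsProbabilityMeasure q] :
    (meanReturn q)⁻¹ ≤ invariantLaw q {0} := by
  rw [← lintegral_indicator_one (measurableSet_singleton _), lintegral_invariantLaw]
  refine le_mul_of_one_le_right (zero_le) ?_
  calc (1 : ENNReal) = ∫⁻ _, 1 ∂q := by simp
    _ ≤ _ := lintegral_mono fun m => by
      refine le_trans ?_ (Finset.single_le_sum (fun _ _ => zero_le)
        (Finset.mem_range.2 (Nat.succ_pos m.natAbs)))
      simp

theorem map_neg_invariantLaw (q : Measure ℤ) (hq : q.map (fun m => -m) = q) :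
    (invariantLaw q).map (fun m => -m) = invariantLaw q := by
  refine Measure.ext_of_lintegral _ fun h hh => ?_
  rw [lintegral_map hh (measurable_of_countable _), lintegral_invariantLaw, lintegral_invariantLaw]
  congr 1
  conv_rhs => rw [← hq, lintegral_map (measurable_of_countable _) (measurable_of_countable _)]
  simp

/-! ### The conditional expectation of the partial sums -/

/-- The conditional expectation of the sign at time `j`, given the state `m` at time `0`. -/
noncomputable def meanSign (j : ℕ) (m : ℤ) : ℝ := if j < m.natAbs then (m.sign : ℝ) else 0

/-- The chain is at `0` at time `|m|`, and `step` is odd in the pair of state and innovation. -/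
theorem chain_flipOn_tail (m : ℤ) (u : ℕ → ℤ) (j : ℕ) (hj : m.natAbs ≤ j) :
    chain j (m, flipOn (fun i => m.natAbs ≤ i) u) = -chain j (m, u) := by
  induction j, hj using Nat.le_induction with
  | base =>
    have h2 := fun u => step_iterate_sign m m.natAbs le_rfl (m, u) 0 rfl
    simp only [zero_add, Int.sign_mul_natAbs, sub_self] at h2
    rw [h2, h2, neg_zero]
  | succ j hj ih =>
    rw [chain, chain, ih]
    simp only [flipOn, hj, if_true, step, neg_eq_zero, Int.sign_neg]
    split_ifs <;> ring

theorem abs_sign_le_one (m : ℤ) : |(m.sign : ℝ)| ≤ 1 := by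
  rcases Int.sign_trichotomy m with h | h | h <;> simp [h]

theorem measurable_sign_chain (j : ℕ) : Measurable fun ω => ((chain j ω).sign : ℝ) :=
  (measurable_of_countable (fun m : ℤ => (m.sign : ℝ))).comp (measurable_chain j)

/-- The sign is constant until `0` is reached. From then on, reflecting the later innovations shows
that the expectation equals its own negative. -/
theorem integral_sign_chain (q : Measure ℤ) [IsProbabilityMeasure q]
    (hq : q.map (fun m => -m) = q) (m : ℤ) (j : ℕ) :
    ∫ u, ((chain j (m, u)).sign : ℝ) ∂(seqLaw q) = meanSign j m := by
  unfold meanSign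
  split_ifs with hj
  · have h : ∀ u, (chain j (m, u)).sign = m.sign := fun u => by
      have := step_iterate_sign m j hj.le (m, u) 0 rfl
      rw [zero_add] at this
      rw [this]
      rcases lt_trichotomy m 0 with h | h | h
      · rw [Int.sign_eq_neg_one_of_neg h, Int.sign_eq_neg_one_of_neg (by omega)]
      · simp [h] at hj
      · rw [Int.sign_eq_one_of_pos h, Int.sign_eq_one_of_pos (by omega)]
    simp [h]
  · have hp := measurePreserving_flipOn q hq (fun i => m.natAbs ≤ i)
    have hm : Measurable fun u : ℕ → ℤ => ((chain j (m, u)).sign : ℝ) :=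
      (measurable_sign_chain j).comp measurable_prodMk_left
    have h1 : ∫ u, ((chain j (m, u)).sign : ℝ) ∂(seqLaw q)
        = ∫ u, -((chain j (m, u)).sign : ℝ) ∂(seqLaw q) := by
      conv_lhs => rw [← hp.map_eq, integral_map hp.measurable.aemeasurable
        hm.aestronglyMeasurable]
      refine integral_congr_ae (ae_of_all _ fun u => ?_)
      simp only
      rw [chain_flipOn_tail m u j (by omega), Int.sign_neg]
      push_cast; rfl
    rw [integral_neg] at h1
    linarith

theorem integrable_sign_chain (μ : Measure (ℤ × (ℕ → ℤ))) [IsFiniteMeasure μ] (j : ℕ) :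
    Integrable (fun ω => ((chain j ω).sign : ℝ)) μ :=
  Integrable.of_bound (measurable_sign_chain j).aestronglyMeasurable 1
    (ae_of_all _ fun _ => abs_sign_le_one _)

theorem memLp_sign_chain (μ : Measure (ℤ × (ℕ → ℤ))) [IsFiniteMeasure μ] (j : ℕ) :
    MemLp (fun ω => ((chain j ω).sign : ℝ)) 2 μ :=
  MemLp.of_bound (measurable_sign_chain j).aestronglyMeasurable 1
    (ae_of_all _ fun _ => abs_sign_le_one _)

theorem integral_sign_chain_eq_zero (q : Measure ℤ) [IsProbabilityMeasure q]
    (hq : q.map (fun m => -m) = q) (hZ : meanReturn q ≠ ⊤) (j : ℕ) :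
    ∫ ω, ((chain j ω).sign : ℝ) ∂((invariantLaw q).prod (seqLaw q)) = 0 := by
  have := isProbabilityMeasure_invariantLaw q hZ
  have hc := measurePreserving_chain _ q (isInvariant_invariantLaw q hZ) j
  have hs : Measurable (fun m : ℤ => (m.sign : ℝ)) := measurable_of_countable _
  rw [← integral_map (φ := chain j) (f := fun m : ℤ => (m.sign : ℝ)) hc.measurable.aemeasurable
    hs.aestronglyMeasurable, hc.map_eq]
  have h1 : ∫ m, (m.sign : ℝ) ∂(invariantLaw q) = ∫ m, -(m.sign : ℝ) ∂(invariantLaw q) := by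
    conv_lhs => rw [← map_neg_invariantLaw q hq, integral_map
      (measurable_of_countable _).aemeasurable hs.aestronglyMeasurable]
    simp
  rw [integral_neg] at h1
  linarith

theorem condExp_partialSum (q : Measure ℤ) [IsProbabilityMeasure q]
    (hq : q.map (fun m => -m) = q) (hZ : meanReturn q ≠ ⊤) (n : ℕ) :
    ((invariantLaw q).prod (seqLaw q))[StationaryChain.partialSum (fun m : ℤ => (m.sign : ℝ))
        chain n | MeasurableSpace.comap (chain 0) inferInstance]
      =ᵐ[(invariantLaw q).prod (seqLaw q)]
      fun ω => ∑ j ∈ Finset.Icc 1 n, meanSign j ω.1 := by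
  have := isProbabilityMeasure_invariantLaw q hZ
  have hm : MeasurableSpace.comap (chain 0) inferInstance
      ≤ (inferInstance : MeasurableSpace (ℤ × (ℕ → ℤ))) := (measurable_chain 0).comap_le
  have hint : Integrable (StationaryChain.partialSum (fun m : ℤ => (m.sign : ℝ)) chain n)
      ((invariantLaw q).prod (seqLaw q)) := by
    unfold StationaryChain.partialSum
    exact integrable_finsetSum _ fun j _ => integrable_sign_chain _ j
  have hmeas : Measurable fun m : ℤ => ∑ j ∈ Finset.Icc 1 n, meanSign j m :=
    measurable_of_countable _
  have hbound : ∀ m : ℤ, |∑ j ∈ Finset.Icc 1 n, meanSign j m| ≤ n := fun m => by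
    refine (Finset.abs_sum_le_sum_abs _ _).trans
      ((Finset.sum_le_card_nsmul _ _ 1 fun j _ => ?_).trans (by simp))
    unfold meanSign
    split_ifs
    · exact abs_sign_le_one m
    · simp
  have hint' : Integrable (fun ω : ℤ × (ℕ → ℤ) => ∑ j ∈ Finset.Icc 1 n, meanSign j ω.1)
      ((invariantLaw q).prod (seqLaw q)) :=
    Integrable.of_bound (hmeas.comp measurable_fst).aestronglyMeasurable n
      (ae_of_all _ fun ω => hbound ω.1)
  refine (ae_eq_condExp_of_forall_setIntegral_eq hm hint (fun _ _ _ => hint'.integrableOn)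
    ?_ ?_).symm
  · rintro _ ⟨s, hs, rfl⟩ -
    -- Events of $\sigma(Y_0)$ are rectangles, so Fubini reduces the claim to the sections at fixed
    -- `m`.
    have h1 : chain 0 ⁻¹' s = s ×ˢ (Set.univ : Set (ℕ → ℤ)) := by ext; simp [chain]
    rw [h1, setIntegral_prod _ hint'.integrableOn, setIntegral_prod _ hint.integrableOn]
    refine integral_congr_ae (ae_of_all _ fun m => ?_)
    simp only [Measure.restrict_univ, integral_const, probReal_univ, one_smul,
      StationaryChain.partialSum]
    rw [integral_finsetSum]
    · exact Finset.sum_congr rfl fun j _ => (integral_sign_chain q hq m j).symm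
    · intro j _
      exact Integrable.of_bound
        ((measurable_sign_chain j).comp measurable_prodMk_left).aestronglyMeasurable 1
        (ae_of_all _ fun _ => abs_sign_le_one _)
  · exact (hmeas.comp (comap_measurable (chain 0))).aestronglyMeasurable

theorem abs_sum_meanSign_le (n : ℕ) (m : ℤ) :
    |∑ j ∈ Finset.Icc 1 n, meanSign j m| ≤ (min n m.natAbs : ℕ) := by
  calc |∑ j ∈ Finset.Icc 1 n, meanSign j m|
      ≤ ∑ j ∈ Finset.Icc 1 n, |meanSign j m| := Finset.abs_sum_le_sum_abs _ _
    _ ≤ ∑ j ∈ Finset.Icc 1 n, if j < m.natAbs then (1 : ℝ) else 0 := by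
      refine Finset.sum_le_sum fun j _ => ?_
      unfold meanSign
      split_ifs
      · exact abs_sign_le_one m
      · simp
    _ = (((Finset.Icc 1 n).filter (· < m.natAbs)).card : ℝ) := by simp
    _ ≤ (min n m.natAbs : ℕ) := by
      refine Nat.cast_le.2 ?_
      have : (Finset.Icc 1 n).filter (· < m.natAbs) ⊆ Finset.Icc 1 (min n m.natAbs) := by
        intro j hj
        simp only [Finset.mem_filter, Finset.mem_Icc] at hj ⊢
        omega
      simpa using Finset.card_le_card this

/-- Each of the `|m|` nonzero points of a loop contributes at most $\min(n,|m|)^2$ and the point `0`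
contributes nothing. The normalizing factor is at most `1` and is dropped. -/
theorem sq_l2Norm_condExp_le (q : Measure ℤ) [IsProbabilityMeasure q]
    (hq : q.map (fun m => -m) = q) (hZ : meanReturn q ≠ ⊤) (n : ℕ) :
    ENNReal.ofReal (StationaryChain.l2Norm ((invariantLaw q).prod (seqLaw q))
      (((invariantLaw q).prod (seqLaw q))[StationaryChain.partialSum (fun m : ℤ => (m.sign : ℝ))
        chain n | MeasurableSpace.comap (chain 0) inferInstance])) ^ 2
      ≤ ∫⁻ m, (m.natAbs : ENNReal) * (min n m.natAbs : ℕ) ^ 2 ∂q := by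
  have := isProbabilityMeasure_invariantLaw q hZ
  have h1 := condExp_partialSum q hq hZ n
  have hmeas : Measurable fun m : ℤ => (∑ j ∈ Finset.Icc 1 n, meanSign j m) ^ 2 :=
    measurable_of_countable _
  unfold StationaryChain.l2Norm
  rw [← ENNReal.ofReal_pow (Real.sqrt_nonneg _), Real.sq_sqrt (integral_nonneg fun _ => sq_nonneg _),
    integral_congr_ae (g := fun ω => (∑ j ∈ Finset.Icc 1 n, meanSign j ω.1) ^ 2)
      (h1.mono fun ω hω => by simp only [hω]),
    integral_eq_lintegral_of_nonneg_ae (ae_of_all _ fun _ => sq_nonneg _)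
      (hmeas.comp measurable_fst).aestronglyMeasurable]
  -- This inequality holds even for an infinite integral, so finiteness need not be checked.
  refine ENNReal.ofReal_toReal_le.trans ?_
  have hfst : MeasurePreserving Prod.fst ((invariantLaw q).prod (seqLaw q)) (invariantLaw q) :=
    measurePreserving_fst
  rw [hfst.lintegral_comp (f := fun m => ENNReal.ofReal ((∑ j ∈ Finset.Icc 1 n, meanSign j m) ^ 2))
    (measurable_of_countable _), lintegral_invariantLaw]
  calc _ ≤ 1 * _ := mul_le_mul_left (ENNReal.inv_le_one.2 (one_le_meanReturn q)) _
    _ ≤ _ := by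
      rw [one_mul]
      refine lintegral_mono fun m => ?_
      have hle : ∀ j ∈ Finset.range (m.natAbs + 1),
          ENNReal.ofReal ((∑ i ∈ Finset.Icc 1 n, meanSign i (m.sign * (j : ℤ))) ^ 2)
            ≤ ((min n j : ℕ) : ENNReal) ^ 2 := fun j _ => by
        have hj : (m.sign * (j : ℤ)).natAbs ≤ j := by
          rw [Int.natAbs_mul, Int.natAbs_natCast]
          rcases Int.sign_trichotomy m with h | h | h <;> simp [h]
        rw [← ENNReal.ofReal_natCast, ← ENNReal.ofReal_pow (Nat.cast_nonneg _)]
        refine ENNReal.ofReal_le_ofReal (sq_le_sq' ?_ ?_)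
        all_goals
          have := abs_le.1 ((abs_sum_meanSign_le n (m.sign * (j : ℤ))).trans
            (Nat.cast_le.2 (min_le_min_left n hj)))
          linarith [this.1, this.2]
      refine (Finset.sum_le_sum hle).trans ?_
      rw [Finset.sum_range_succ']
      simp only [Nat.cast_zero, ne_eq, OfNat.ofNat_ne_zero, not_false_eq_true,
        zero_pow, add_zero, min_zero]
      refine (Finset.sum_le_card_nsmul _ _ (((min n m.natAbs : ℕ) : ENNReal) ^ 2)
        fun j hj => ?_).trans (by simp)
      have := Finset.mem_range.1 hj
      gcongr
      omega

/-! ### Reflecting one loop: a lower bound for large partial sums -/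

/-- The change of sign of the innovation with index `i`. -/
def flipAt (i : ℕ) (ω : ℤ × (ℕ → ℤ)) : ℤ × (ℕ → ℤ) := (ω.1, flipOn (fun k => k = i) ω.2)

theorem measurePreserving_flipAt (π q : Measure ℤ) [IsProbabilityMeasure π]
    [IsProbabilityMeasure q] (hq : q.map (fun m => -m) = q) (i : ℕ) :
    MeasurePreserving (flipAt i) (π.prod (seqLaw q)) (π.prod (seqLaw q)) :=
  (MeasurePreserving.id π).prod (measurePreserving_flipOn q hq fun k => k = i)

theorem chain_flipAt_of_le {i k : ℕ} (h : k ≤ i) (ω : ℤ × (ℕ → ℤ)) :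
    chain k (flipAt i ω) = chain k ω :=
  chain_congr k rfl fun j hj => by simp [flipAt, flipOn, show j ≠ i by omega]

theorem chain_excursion {i l : ℕ} {ω : ℤ × (ℕ → ℤ)} (h0 : chain i ω = 0)
    (hl : l ≤ (ω.2 i).natAbs) :
    chain (i + 1 + l) ω = ω.2 i - (ω.2 i).sign * l :=
  step_iterate_sign _ l hl ω (i + 1) (by simp [chain, step, h0])

/-- The loop and its mirror image have the same length, so both paths are at `0` when it ends, and
the later innovations agree. -/
theorem chain_flipAt_of_ge {i k : ℕ} {ω : ℤ × (ℕ → ℤ)} (h0 : chain i ω = 0)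
    (hk : i + 1 + (ω.2 i).natAbs ≤ k) : chain k (flipAt i ω) = chain k ω := by
  induction k, hk using Nat.le_induction with
  | base =>
    have h0' : chain i (flipAt i ω) = 0 := by rw [chain_flipAt_of_le le_rfl, h0]
    have hf : (flipAt i ω).2 i = -ω.2 i := by simp [flipAt, flipOn]
    have h1 := chain_excursion h0' (l := (ω.2 i).natAbs) (by rw [hf, Int.natAbs_neg])
    rw [h1, chain_excursion h0 le_rfl, hf, Int.sign_neg, Int.sign_mul_natAbs, neg_mul,
      Int.sign_mul_natAbs]
    ring
  | succ k hk ih =>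
    rw [chain, chain, ih]
    simp [flipAt, flipOn, show k ≠ i by omega]

theorem sign_excursion {x : ℤ} {l : ℕ} (hl : l < x.natAbs) : (x - x.sign * l).sign = x.sign := by
  rcases lt_trichotomy x 0 with h | h | h
  · rw [Int.sign_eq_neg_one_of_neg h, Int.sign_eq_neg_one_of_neg (by omega)]
  · simp [h] at hl
  · rw [Int.sign_eq_one_of_pos h, Int.sign_eq_one_of_pos (by omega)]

/-- The signs differ only during the loop, where they are opposite; `hn` ensures that the whole loop
is counted. -/
theorem partialSum_sub_flipAt {i n : ℕ} {ω : ℤ × (ℕ → ℤ)} (h0 : chain i ω = 0)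
    (hn : i + (ω.2 i).natAbs ≤ n) :
    StationaryChain.partialSum (fun m : ℤ => (m.sign : ℝ)) chain n ω
      - StationaryChain.partialSum (fun m : ℤ => (m.sign : ℝ)) chain n (flipAt i ω)
      = 2 * (ω.2 i : ℝ) := by
  unfold StationaryChain.partialSum
  rw [← Finset.sum_sub_distrib]
  have h0' : chain i (flipAt i ω) = 0 := by rw [chain_flipAt_of_le le_rfl, h0]
  have hf : (flipAt i ω).2 i = -ω.2 i := by simp [flipAt, flipOn]
  have h1 : ∀ k ∈ Finset.Icc 1 n, ((chain k ω).sign : ℝ) - ((chain k (flipAt i ω)).sign : ℝ)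
      = if k ∈ Finset.Icc (i + 1) (i + (ω.2 i).natAbs) then 2 * ((ω.2 i).sign : ℝ) else 0 := by
    intro k _
    split_ifs with hk
    · rw [Finset.mem_Icc] at hk
      obtain ⟨l, rfl⟩ := Nat.exists_eq_add_of_le hk.1
      have hl : l < (ω.2 i).natAbs := by omega
      rw [chain_excursion h0 hl.le, chain_excursion h0' (by rw [hf, Int.natAbs_neg]; exact hl.le),
        sign_excursion hl, sign_excursion (by rw [hf, Int.natAbs_neg]; exact hl), hf, Int.sign_neg]
      push_cast; ring
    · rw [Finset.mem_Icc, not_and_or, not_le, not_le] at hk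
      rcases hk with hk | hk
      · rw [chain_flipAt_of_le (by omega), sub_self]
      · rw [chain_flipAt_of_ge h0 (by omega), sub_self]
  rw [Finset.sum_congr rfl h1, Finset.sum_ite_mem, Finset.inter_eq_right.2, Finset.sum_const,
    Nat.card_Icc]
  · have h2 : (((ω.2 i).sign * (ω.2 i).natAbs : ℤ) : ℝ) = (ω.2 i : ℝ) := by
      rw [Int.sign_mul_natAbs]
    rw [← h2, nsmul_eq_mul, show i + (ω.2 i).natAbs + 1 - (i + 1) = (ω.2 i).natAbs by omega]
    push_cast [-Int.natCast_natAbs]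
    ring
  · intro k hk
    rw [Finset.mem_Icc] at hk ⊢
    omega

/-- The event that at time `i` an excursion of length `v` starts, while no earlier innovation has
absolute value `v`. -/
def firstJump (v i : ℕ) : Set (ℤ × (ℕ → ℤ)) :=
  {ω | chain i ω = 0 ∧ (ω.2 i).natAbs = v ∧ ∀ j < i, (ω.2 j).natAbs ≠ v}

theorem measurableSet_innovation (s : Set ℤ) (i : ℕ) :
    MeasurableSet {ω : ℤ × (ℕ → ℤ) | ω.2 i ∈ s} :=
  ((measurable_pi_apply i).comp measurable_snd) (MeasurableSet.of_discrete (s := s))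

theorem measurableSet_firstJump (v i : ℕ) : MeasurableSet (firstJump v i) := by
  have h : firstJump v i = chain i ⁻¹' {0} ∩ ({ω | ω.2 i ∈ {x : ℤ | x.natAbs = v}} ∩
      ⋂ j, ⋂ (_ : j < i), {ω | ω.2 j ∈ {x : ℤ | x.natAbs ≠ v}}) := by
    ext ω; simp [firstJump]
  rw [h]
  exact (measurable_chain i (measurableSet_singleton 0)).inter ((measurableSet_innovation _ i).inter
    (MeasurableSet.iInter fun j => MeasurableSet.iInter fun _ => measurableSet_innovation _ j))

theorem preimage_flipAt_firstJump (v i : ℕ) : flipAt i ⁻¹' firstJump v i = firstJump v i := by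
  ext ω
  have h1 : ∀ j, ((flipAt i ω).2 j).natAbs = (ω.2 j).natAbs := fun j => by
    by_cases h : j = i <;> simp [flipAt, flipOn, h]
  simp only [firstJump, Set.mem_preimage, Set.mem_ofPred_eq, h1, chain_flipAt_of_le le_rfl]

/-- The sums along a path and its reflection differ by `2 * v` in absolute value, so they cannot
both lie strictly within `v` of `0`. The reflection preserves the law and the event `firstJump v i`.
-/
theorem measure_firstJump_le (π q : Measure ℤ) [IsProbabilityMeasure π] [IsProbabilityMeasure q]
    (hq : q.map (fun m => -m) = q) {v i n : ℕ} (hn : i + v ≤ n) :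
    π.prod (seqLaw q) (firstJump v i) ≤ 2 * π.prod (seqLaw q) (firstJump v i ∩ {ω | (v : ℝ) ≤
      |StationaryChain.partialSum (fun m : ℤ => (m.sign : ℝ)) chain n ω|}) := by
  set G := {ω | (v : ℝ) ≤
      |StationaryChain.partialSum (fun m : ℤ => (m.sign : ℝ)) chain n ω|} with hG
  have hGm : MeasurableSet G := by
    refine measurableSet_le measurable_const (Measurable.abs ?_)
    unfold StationaryChain.partialSum
    exact Finset.measurable_sum _ fun j _ => measurable_sign_chain j
  have hsub : firstJump v i ⊆ (firstJump v i ∩ G) ∪ (flipAt i ⁻¹' (firstJump v i ∩ G)) := by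
    intro ω hω
    rw [Set.preimage_inter, preimage_flipAt_firstJump, ← Set.inter_union_distrib_left]
    refine ⟨hω, ?_⟩
    by_contra hcon
    rw [Set.mem_union, not_or] at hcon
    obtain ⟨h0, hv, -⟩ := hω
    have hd := partialSum_sub_flipAt h0 (n := n) (by omega)
    have h1 := hcon.1
    have h2 := hcon.2
    simp only [hG, Set.mem_preimage, Set.mem_ofPred_eq, not_le] at h1 h2
    have h3 : |2 * (ω.2 i : ℝ)| = 2 * v := by
      rw [abs_mul, abs_two, ← hv, Nat.cast_natAbs, Int.cast_abs]
    have h4 := abs_sub (StationaryChain.partialSum (fun m : ℤ => (m.sign : ℝ)) chain n ω)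
      (StationaryChain.partialSum (fun m : ℤ => (m.sign : ℝ)) chain n (flipAt i ω))
    rw [hd, h3] at h4
    linarith
  refine (measure_mono hsub).trans ((measure_union_le _ _).trans ?_)
  rw [(measurePreserving_flipAt π q hq i).measure_preimage
    ((measurableSet_firstJump v i).inter hGm).nullMeasurableSet, two_mul]

/-- The state at time `i` has law `π` and is independent of innovation `i`. A jump of size `v` there
fails to be the first only if an earlier innovation also has size `v`; a union bound over the `i`
pairs gives the error term. -/
theorem le_measure_firstJump_add (q : Measure ℤ) [IsProbabilityMeasure q] (π : Measure ℤ)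
    [IsProbabilityMeasure π] (hinv : IsInvariant π q) (v i : ℕ) :
    π {0} * q {x | x.natAbs = v}
      ≤ π.prod (seqLaw q) (firstJump v i) + i * q {x | x.natAbs = v} ^ 2 := by
  set μ := π.prod (seqLaw q) with hμ
  set s : Set ℤ := {x | x.natAbs = v} with hs
  have htail : ∀ {B : Set (ℤ × (ℕ → ℤ))}, MeasurableSet B → (∀ ω ω' : ℤ × (ℕ → ℤ), ω.1 = ω'.1 →
      (∀ k < i, ω.2 k = ω'.2 k) → ω ∈ B → ω' ∈ B) → μ (B ∩ {ω | ω.2 i ∈ s}) = μ B * q s := by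
    intro B hB hdep
    have hD : MeasurableSet {u : ℕ → ℤ | u 0 ∈ s} :=
      (measurable_pi_apply 0) (MeasurableSet.of_discrete (s := s))
    rw [← seqLaw_eval q 0 s, ← prod_inter_tail π q hD i hB hdep]
    simp [seqTail, hμ]
  have hstart : μ (chain i ⁻¹' {0} ∩ {ω | ω.2 i ∈ s}) = π {0} * q s := by
    rw [htail (measurable_chain i (measurableSet_singleton 0)),
      (measurePreserving_chain π q hinv i).measure_preimage
        (measurableSet_singleton 0).nullMeasurableSet]
    intro ω ω' h0 h1 h
    rw [Set.mem_preimage, ← chain_congr i h0 h1]; exact h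
  have hpair : ∀ j ∈ Finset.range i, μ ({ω | ω.2 j ∈ s} ∩ {ω | ω.2 i ∈ s}) = q s ^ 2 := by
    intro j hj
    have hj := Finset.mem_range.1 hj
    rw [htail (measurableSet_innovation s j) fun ω ω' _ h1 h => by
      simpa [← h1 j hj] using h, sq]
    congr 1
    rw [← seqLaw_eval q j s]
    exact (measurePreserving_snd (μ := π) (ν := seqLaw q)).measure_preimage
      (((measurable_pi_apply j) (MeasurableSet.of_discrete (s := s))).nullMeasurableSet)
  rw [← hstart]
  have hsub : chain i ⁻¹' {0} ∩ {ω | ω.2 i ∈ s} ⊆ firstJump v i ∪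
      ⋃ j ∈ Finset.range i, ({ω | ω.2 j ∈ s} ∩ {ω | ω.2 i ∈ s}) := by
    rintro ω ⟨h0, h1⟩
    by_cases h : ∀ j < i, (ω.2 j).natAbs ≠ v
    · exact Or.inl ⟨h0, h1, h⟩
    · push Not at h
      obtain ⟨j, hj, hv⟩ := h
      refine Or.inr (Set.mem_biUnion (Finset.mem_coe.2 (Finset.mem_range.2 hj)) ⟨hv, h1⟩)
  refine (measure_mono hsub).trans ((measure_union_le _ _).trans ?_)
  gcongr
  refine (measure_biUnion_finset_le _ _).trans ?_
  rw [Finset.sum_congr rfl hpair]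
  simp

/-- Within `n ≥ m + v` steps the partial sum reaches the level `v` with a probability that is
controlled from below by the expected number of excursions of length `v` started before `m`. -/
theorem le_measure_partialSum (q : Measure ℤ) [IsProbabilityMeasure q]
    (hq : q.map (fun m => -m) = q) (π : Measure ℤ) [IsProbabilityMeasure π]
    (hinv : IsInvariant π q) {v m n : ℕ} (hn : m + v ≤ n) :
    m * (π {0} * q {x | x.natAbs = v})
      ≤ 2 * π.prod (seqLaw q) {ω | (v : ℝ) ≤
          |StationaryChain.partialSum (fun m : ℤ => (m.sign : ℝ)) chain n ω|}
        + (m * q {x | x.natAbs = v}) ^ 2 := by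
  set μ := π.prod (seqLaw q) with hμ
  set G := {ω | (v : ℝ) ≤
      |StationaryChain.partialSum (fun m : ℤ => (m.sign : ℝ)) chain n ω|} with hG
  have hGm : MeasurableSet G := by
    refine measurableSet_le measurable_const (Measurable.abs ?_)
    unfold StationaryChain.partialSum
    exact Finset.measurable_sum _ fun j _ => measurable_sign_chain j
  have h1 : ∀ i ∈ Finset.range m, π {0} * q {x | x.natAbs = v}
      ≤ 2 * μ (firstJump v i ∩ G) + m * q {x | x.natAbs = v} ^ 2 := fun i hi => by
    have hi := Finset.mem_range.1 hi
    refine (le_measure_firstJump_add q π hinv v i).trans ?_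
    gcongr
    exact measure_firstJump_le π q hq (by omega)
  -- Requiring the first innovation of size `v` makes the events disjoint, so their probabilities
  -- add up.
  have h2 : ∑ i ∈ Finset.range m, μ (firstJump v i ∩ G) ≤ μ G := by
    rw [← measure_biUnion_finset]
    · exact measure_mono (Set.iUnion₂_subset fun i _ => Set.inter_subset_right)
    · intro i _ j _ hij
      refine Set.disjoint_left.2 ?_
      rintro ω ⟨⟨_, hi, hi'⟩, _⟩ ⟨⟨_, hj, hj'⟩, _⟩
      rcases lt_or_gt_of_ne hij with h | h
      · exact hj' i h hi
      · exact hi' j h hj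
    · exact fun i _ => (measurableSet_firstJump v i).inter hGm
  calc m * (π {0} * q {x | x.natAbs = v})
      = ∑ i ∈ Finset.range m, π {0} * q {x | x.natAbs = v} := by simp
    _ ≤ ∑ i ∈ Finset.range m, (2 * μ (firstJump v i ∩ G) + m * q {x | x.natAbs = v} ^ 2) :=
      Finset.sum_le_sum h1
    _ = 2 * ∑ i ∈ Finset.range m, μ (firstJump v i ∩ G) + (m * q {x | x.natAbs = v}) ^ 2 := by
      rw [Finset.sum_add_distrib, ← Finset.mul_sum]
      simp; ring
    _ ≤ _ := by gcongr

/-! ### Symmetric jump laws -/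

/-- The symmetric law on `ℤ` charging `±v k` with total mass `p k`, the remaining mass being put
at `0`. -/
noncomputable def jumpLaw (p : ℕ → ENNReal) (v : ℕ → ℕ) : Measure ℤ :=
  (1 - ∑' k, p k) • Measure.dirac 0
    + Measure.sum fun k => (p k / 2) • (Measure.dirac (v k : ℤ) + Measure.dirac (-(v k : ℤ)))

theorem lintegral_jumpLaw (p : ℕ → ENNReal) (v : ℕ → ℕ) (h : ℤ → ENNReal) :
    ∫⁻ m, h m ∂(jumpLaw p v)
      = (1 - ∑' k, p k) * h 0 + ∑' k, p k / 2 * (h (v k : ℤ) + h (-(v k : ℤ))) := by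
  simp [jumpLaw, lintegral_add_measure, lintegral_sum_measure, mul_add]

theorem lintegral_jumpLaw_of_even (p : ℕ → ENNReal) (v : ℕ → ℕ) (h : ℤ → ENNReal)
    (heven : ∀ m, h (-m) = h m) :
    ∫⁻ m, h m ∂(jumpLaw p v) = (1 - ∑' k, p k) * h 0 + ∑' k, p k * h (v k : ℤ) := by
  rw [lintegral_jumpLaw]
  congr 1
  refine tsum_congr fun k => ?_
  rw [heven, ← two_mul, ← mul_assoc, ENNReal.div_mul_cancel two_ne_zero ENNReal.ofNat_ne_top]

theorem isProbabilityMeasure_jumpLaw {p : ℕ → ENNReal} (v : ℕ → ℕ) (hp : ∑' k, p k ≤ 1) :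
    IsProbabilityMeasure (jumpLaw p v) := by
  constructor
  rw [← lintegral_one, lintegral_jumpLaw_of_even _ _ _ fun _ => rfl]
  simpa using tsub_add_cancel_of_le hp

theorem map_neg_jumpLaw (p : ℕ → ENNReal) (v : ℕ → ℕ) :
    (jumpLaw p v).map (fun m => -m) = jumpLaw p v := by
  refine Measure.ext_of_lintegral _ fun h hh => ?_
  rw [lintegral_map hh (measurable_of_countable _), lintegral_jumpLaw, lintegral_jumpLaw]
  simp [add_comm]

theorem jumpLaw_apply (p : ℕ → ENNReal) (v : ℕ → ℕ) (s : Set ℤ) :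
    jumpLaw p v s = (1 - ∑' k, p k) * s.indicator 1 0
      + ∑' k, p k / 2 * (s.indicator 1 (v k : ℤ) + s.indicator 1 (-(v k : ℤ))) := by
  rw [← lintegral_jumpLaw, lintegral_indicator_one MeasurableSet.of_discrete]

theorem spread_jumpLaw {p : ℕ → ENNReal} {v : ℕ → ℕ} (hp : ∑' k, p k < 1) (hp0 : ∀ k, p k ≠ 0)
    (hv : StrictMono v) : Spread (jumpLaw p v) := by
  refine ⟨?_, fun N => ⟨v N, hv.le_apply, ?_, ?_⟩⟩
  · rw [jumpLaw_apply]
    refine fun h => (tsub_pos_of_lt hp).ne' ?_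
    simpa using (add_eq_zero.1 h).1
  all_goals
    rw [jumpLaw_apply]
    refine fun h => hp0 N ?_
    have := ENNReal.tsum_eq_zero.1 (add_eq_zero.1 h).2 N
    simpa using this

theorem jumpLaw_natAbs_eq {p : ℕ → ENNReal} {v : ℕ → ℕ} (hv : StrictMono v) {k : ℕ}
    (hk : v k ≠ 0) : jumpLaw p v {x | x.natAbs = v k} = p k := by
  rw [← lintegral_indicator_one MeasurableSet.of_discrete,
    lintegral_jumpLaw_of_even _ _ _ fun m => by simp [Set.indicator]]
  simp [Set.indicator, hk.symm, hv.injective.eq_iff]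

theorem meanReturn_jumpLaw {p : ℕ → ENNReal} {v : ℕ → ℕ} (hp : ∑' k, p k ≤ 1) :
    meanReturn (jumpLaw p v) = ∑' k, p k * v k + 1 := by
  have := isProbabilityMeasure_jumpLaw v hp
  rw [meanReturn, lintegral_add_right _ measurable_const,
    lintegral_jumpLaw_of_even _ _ _ fun m => by rw [Int.natAbs_neg]]
  simp

/-! ### The summation kernel -/

/-- The summation kernel `n ↦ min(n, v) / (√v n^{3/2})`. -/
noncomputable def kernelWeight (v n : ℕ) : ℝ := (min n v : ℕ) / √(v : ℝ) / (n : ℝ) ^ (3 / 2 : ℝ)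

theorem kernelWeight_nonneg (v n : ℕ) : 0 ≤ kernelWeight v n := by
  unfold kernelWeight; positivity

theorem rpow_three_halves (n : ℕ) : (n : ℝ) ^ (3 / 2 : ℝ) = √(n : ℝ) ^ 3 := by
  rw [Real.sqrt_eq_rpow, ← Real.rpow_natCast, ← Real.rpow_mul (Nat.cast_nonneg n)]
  norm_num

theorem kernelWeight_le (v n : ℕ) : kernelWeight v n ≤ 1 / √(v : ℝ) := by
  unfold kernelWeight
  rcases Nat.eq_zero_or_pos n with rfl | hn
  · simp
  · rw [div_right_comm]
    gcongr
    have h1 : (1 : ℝ) ≤ n := by exact_mod_cast hn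
    rw [div_le_one (by positivity)]
    calc ((min n v : ℕ) : ℝ) ≤ n := by exact_mod_cast min_le_left _ _
      _ = (n : ℝ) ^ (1 : ℝ) := (Real.rpow_one _).symm
      _ ≤ _ := Real.rpow_le_rpow_of_exponent_le h1 (by norm_num)

theorem one_div_sqrt_succ_le (n : ℕ) :
    1 / √((n + 1 : ℕ) : ℝ) ≤ 2 * (√((n + 1 : ℕ) : ℝ) - √(n : ℝ)) := by
  have ht : 0 < √((n + 1 : ℕ) : ℝ) := by positivity
  have h1 : √((n + 1 : ℕ) : ℝ) ^ 2 = √(n : ℝ) ^ 2 + 1 := by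
    rw [Real.sq_sqrt (by positivity), Real.sq_sqrt (by positivity)]; push_cast; ring
  rw [div_le_iff₀ ht]
  nlinarith [sq_nonneg (√((n + 1 : ℕ) : ℝ) - √(n : ℝ))]

theorem one_div_sqrt_succ_cube_le {n : ℕ} (hn : 0 < n) :
    1 / √((n + 1 : ℕ) : ℝ) ^ 3 ≤ 2 * (1 / √(n : ℝ) - 1 / √((n + 1 : ℕ) : ℝ)) := by
  have hs : 0 < √(n : ℝ) := by positivity
  have ht : 0 < √((n + 1 : ℕ) : ℝ) := by positivity
  have hst : √(n : ℝ) ≤ √((n + 1 : ℕ) : ℝ) := Real.sqrt_le_sqrt (by push_cast; linarith)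
  have h := one_div_sqrt_succ_le n
  set s := √(n : ℝ)
  set t := √((n + 1 : ℕ) : ℝ)
  calc 1 / t ^ 3 = 1 / t * (1 / (t * t)) := by field_simp
    _ ≤ 1 / t * (1 / (s * t)) := by gcongr
    _ ≤ 2 * (t - s) * (1 / (s * t)) := by gcongr
    _ = 2 * (1 / s - 1 / t) := by field_simp

/-- For `1 ≤ n ≤ v` the weight is $1/\sqrt{nv}$, which is summed by telescoping. -/
theorem sum_kernelWeight_le_of_le {v N : ℕ} (hv : 0 < v) (hN : N ≤ v) :
    ∑ n ∈ Finset.range (N + 1), kernelWeight v n ≤ 2 * √(N : ℝ) / √(v : ℝ) := by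
  induction N with
  | zero => simp [kernelWeight]
  | succ N ih =>
    rw [Finset.sum_range_succ]
    refine (add_le_add_left (ih (by omega)) _).trans ?_
    have h : kernelWeight v (N + 1) = 1 / √((N + 1 : ℕ) : ℝ) / √(v : ℝ) := by
      have ht : 0 < √((N + 1 : ℕ) : ℝ) := by positivity
      have h2 : ((N + 1 : ℕ) : ℝ) = √((N + 1 : ℕ) : ℝ) ^ 2 := by
        rw [Real.sq_sqrt (by positivity)]
      rw [kernelWeight, rpow_three_halves, min_eq_left hN, div_right_comm]
      congr 1
      rw [div_eq_div_iff (by positivity) (by positivity)]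
      nth_rewrite 1 [h2]
      ring
    rw [h, ← add_div]
    gcongr
    linarith [one_div_sqrt_succ_le N]

/-- For `n > v` the weight is $\sqrt v\,n^{-3/2}$. The subtracted term makes the induction
telescope, and at `N = v` the bound equals the value `2` from the other range. -/
theorem sum_kernelWeight_le_of_ge {v N : ℕ} (hv : 0 < v) (hN : v ≤ N) :
    ∑ n ∈ Finset.range (N + 1), kernelWeight v n ≤ 4 - 2 * √(v : ℝ) * (1 / √(N : ℝ)) := by
  have hv' : 0 < √(v : ℝ) := by positivity
  induction N, hN using Nat.le_induction with
  | base =>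
    refine (sum_kernelWeight_le_of_le hv le_rfl).trans (le_of_eq ?_)
    field_simp; norm_num
  | succ N hN ih =>
    rw [Finset.sum_range_succ]
    have h : kernelWeight v (N + 1) = √(v : ℝ) * (1 / √((N + 1 : ℕ) : ℝ) ^ 3) := by
      rw [kernelWeight, rpow_three_halves, min_eq_right (by omega), Real.div_sqrt]; ring
    rw [h]
    have := mul_le_mul_of_nonneg_left (one_div_sqrt_succ_cube_le (hv.trans_le hN)) hv'.le
    linarith

theorem sum_kernelWeight_le {v : ℕ} (hv : 0 < v) (N : ℕ) :
    ∑ n ∈ Finset.range N, kernelWeight v n ≤ 4 := by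
  have h1 : ∑ n ∈ Finset.range N, kernelWeight v n
      ≤ ∑ n ∈ Finset.range (max N v + 1), kernelWeight v n :=
    Finset.sum_le_sum_of_subset_of_nonneg
      (Finset.range_subset_range.2 ((le_max_left _ _).trans (Nat.le_succ _)))
      fun n _ _ => kernelWeight_nonneg v n
  refine h1.trans ((sum_kernelWeight_le_of_ge hv (le_max_right _ _)).trans ?_)
  have : 0 ≤ 2 * √(v : ℝ) * (1 / √((max N v : ℕ) : ℝ)) := by positivity
  linarith

/-- The finitely many terms before `n₀` carry weights at most $1/\sqrt v\to0$; the others have `a n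
≤ ε / 8` against a total weight of at most `4`. -/
theorem eventually_sum_mul_kernelWeight_le {a : ℕ → ℝ} (ha : ∀ n, 0 ≤ a n)
    (hlim : Tendsto a atTop (𝓝 0)) {ε : ℝ} (hε : 0 < ε) :
    ∀ᶠ v : ℕ in atTop, ∀ N, ∑ n ∈ Finset.range N, a n * kernelWeight v n ≤ ε := by
  obtain ⟨n₀, hn₀⟩ := eventually_atTop.1 (hlim.eventually_le_const (show 0 < ε / 8 by positivity))
  have hA : 0 ≤ ∑ n ∈ Finset.range n₀, a n := Finset.sum_nonneg fun n _ => ha n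
  have hlim' : Tendsto (fun v : ℕ => (∑ n ∈ Finset.range n₀, a n) * (1 / √(v : ℝ))) atTop (𝓝 0) := by
    have h : Tendsto (fun v : ℕ => √(v : ℝ)) atTop atTop :=
      Real.tendsto_sqrt_atTop.comp tendsto_natCast_atTop_atTop
    simpa using (h.inv_tendsto_atTop.const_mul (∑ n ∈ Finset.range n₀, a n))
  filter_upwards [hlim'.eventually_le_const (show 0 < ε / 2 by positivity), eventually_gt_atTop 0]
    with v hv hv0 N
  have hterm : ∀ n ∈ Finset.range N, a n * kernelWeight v n
      ≤ (if n ∈ Finset.range n₀ then a n * (1 / √(v : ℝ)) else 0) + ε / 8 * kernelWeight v n := by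
    intro n _
    have hk := kernelWeight_nonneg v n
    split_ifs with h
    · have := mul_le_mul_of_nonneg_left (kernelWeight_le v n) (ha n)
      have : 0 ≤ ε / 8 * kernelWeight v n := by positivity
      linarith
    · rw [zero_add]
      exact mul_le_mul_of_nonneg_right (hn₀ n (by simpa using h)) hk
  refine (Finset.sum_le_sum hterm).trans ?_
  rw [Finset.sum_add_distrib, ← Finset.mul_sum, Finset.sum_ite_mem]
  have h1 : ∑ n ∈ Finset.range N ∩ Finset.range n₀, a n * (1 / √(v : ℝ))
      ≤ (∑ n ∈ Finset.range n₀, a n) * (1 / √(v : ℝ)) := by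
    rw [Finset.sum_mul]
    exact Finset.sum_le_sum_of_subset_of_nonneg Finset.inter_subset_right
      fun n _ _ => mul_nonneg (ha n) (by positivity)
  have h2 := mul_le_mul_of_nonneg_left (sum_kernelWeight_le hv0 N) (show 0 ≤ ε / 8 by positivity)
  linarith

/-! ### Choice of the scales -/

/-- The excursion lengths attached to the scales `ρ k`. -/
def jumpSize (ρ : ℕ → ℕ) (k : ℕ) : ℕ := 2 ^ k * (2 * ρ k)

/-- The probability of an excursion of length `jumpSize ρ k`. -/
noncomputable def jumpProb (ρ : ℕ → ℕ) (k : ℕ) : ENNReal := ENNReal.ofReal (1 / (2 * ρ k) ^ 2)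

/-- The bound `(1 / 4) ^ k` absorbs the factor `2 ^ k` of `scaleTerm`. The growth `8 ^ k` keeps the
total jump mass below `1` and the mean return time at most `2`, and makes `scaleTerm` summable over
the scales. -/
theorem exists_scales {a : ℕ → ℝ} (ha : ∀ n, 0 ≤ a n) (hlim : Tendsto a atTop (𝓝 0)) :
    ∃ ρ : ℕ → ℕ, StrictMono ρ ∧ ∀ k, 8 ^ k ≤ ρ k ∧
      ∀ N, ∑ n ∈ Finset.range N, a n * kernelWeight (jumpSize ρ k) n ≤ (1 / 4) ^ k := by
  obtain ⟨ρ, h1, h2⟩ := extraction_forall_of_eventually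
    (P := fun k m => 8 ^ k ≤ m ∧
      ∀ N, ∑ n ∈ Finset.range N, a n * kernelWeight (2 ^ k * (2 * m)) n ≤ (1 / 4) ^ k)
    fun k => (eventually_ge_atTop _).and <| by
      have ht : Tendsto (fun m : ℕ => 2 ^ k * (2 * m)) atTop atTop :=
        tendsto_atTop_mono (fun m => (Nat.le_mul_of_pos_left m two_pos).trans
          (Nat.le_mul_of_pos_left _ (by positivity))) tendsto_id
      exact ht.eventually (eventually_sum_mul_kernelWeight_le ha hlim (by positivity))
  exact ⟨ρ, h1, h2⟩

theorem strictMono_jumpSize {ρ : ℕ → ℕ} (h : StrictMono ρ) : StrictMono (jumpSize ρ) := by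
  intro j k hjk
  exact Nat.mul_lt_mul_of_le_of_lt (Nat.pow_le_pow_right (by norm_num) hjk.le)
    (Nat.mul_lt_mul_of_pos_left (h hjk) (by norm_num)) (by positivity)

theorem tsum_ofReal_le_geometric {f : ℕ → ℝ} {c : ℝ} (hc : 0 ≤ c)
    (hf : ∀ k, f k ≤ c * (1 / 2) ^ k) :
    ∑' k, ENNReal.ofReal (f k) ≤ ENNReal.ofReal (2 * c) := by
  calc ∑' k, ENNReal.ofReal (f k) ≤ ∑' k : ℕ, ENNReal.ofReal (c * (1 / 2) ^ k) :=
        ENNReal.tsum_le_tsum fun k => ENNReal.ofReal_le_ofReal (hf k)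
    _ = ENNReal.ofReal (2 * c) := by
      rw [← ENNReal.ofReal_tsum_of_nonneg (fun k => by positivity)
        (summable_geometric_two.mul_left c), tsum_mul_left, tsum_geometric_two, mul_comm]

section Scales

variable {ρ : ℕ → ℕ} (hρ : ∀ k, 8 ^ k ≤ ρ k)
include hρ

theorem eight_pow_le_cast (k : ℕ) : (8 : ℝ) ^ k ≤ ρ k := by exact_mod_cast hρ k

theorem scale_pos (k : ℕ) : (0 : ℝ) < ρ k :=
  lt_of_lt_of_le (by positivity) (eight_pow_le_cast hρ k)

theorem jumpProb_ne_zero (k : ℕ) : jumpProb ρ k ≠ 0 := by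
  have := scale_pos hρ k
  exact (ENNReal.ofReal_pos.2 (by positivity)).ne'

theorem tsum_jumpProb_lt_one : ∑' k, jumpProb ρ k < 1 := by
  refine (tsum_ofReal_le_geometric (c := 1 / 4) (by norm_num) fun k => ?_).trans_lt
    (ENNReal.ofReal_lt_one.2 (by norm_num))
  have h := eight_pow_le_cast hρ k
  have h8 : (2 : ℝ) ^ k ≤ 8 ^ k := pow_le_pow_left₀ (by norm_num) (by norm_num) k
  have h1 : (1 : ℝ) ≤ 2 ^ k := one_le_pow₀ (by norm_num)
  calc 1 / (2 * (ρ k : ℝ)) ^ 2 ≤ 1 / (2 * (2 : ℝ) ^ k) ^ 2 := by gcongr; linarith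
    _ = 1 / 4 * (1 / (2 ^ k * 2 ^ k)) := by ring
    _ ≤ 1 / 4 * (1 / (2 ^ k * 1)) := by gcongr
    _ = 1 / 4 * (1 / 2) ^ k := by rw [mul_one, one_div_pow]

theorem jumpProb_mul_jumpSize (k : ℕ) :
    jumpProb ρ k * (jumpSize ρ k : ENNReal) = ENNReal.ofReal (2 ^ k / (2 * ρ k)) := by
  have := scale_pos hρ k
  rw [jumpProb, ← ENNReal.ofReal_natCast, ← ENNReal.ofReal_mul (by positivity)]
  congr 1
  simp only [jumpSize]
  push_cast
  field_simp

theorem meanReturn_le : meanReturn (jumpLaw (jumpProb ρ) (jumpSize ρ)) ≤ 2 := by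
  rw [meanReturn_jumpLaw (tsum_jumpProb_lt_one hρ).le, ← one_add_one_eq_two]
  gcongr
  simp_rw [jumpProb_mul_jumpSize hρ]
  refine (tsum_ofReal_le_geometric (c := 1 / 2) (by norm_num) fun k => ?_).trans (by norm_num)
  have h := eight_pow_le_cast hρ k
  have h4 : (4 : ℝ) ^ k ≤ 8 ^ k := pow_le_pow_left₀ (by norm_num) (by norm_num) k
  calc (2 : ℝ) ^ k / (2 * ρ k) ≤ 2 ^ k / (2 * 4 ^ k) := by gcongr; linarith
    _ = 1 / 2 * (1 / 2) ^ k := by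
      rw [show (4 : ℝ) = 2 * 2 by norm_num, mul_pow, one_div_pow]; field_simp

/-- The contribution of the excursions of length `jumpSize ρ k` to the norm of the conditional
expectation of the partial sum. -/
noncomputable def scaleTerm (ρ : ℕ → ℕ) (n k : ℕ) : ℝ :=
  2 ^ k * ((min n (jumpSize ρ k) : ℕ) / √(jumpSize ρ k : ℝ))

omit hρ in
theorem scaleTerm_nonneg (n k : ℕ) : 0 ≤ scaleTerm ρ n k := by
  unfold scaleTerm; positivity

theorem scaleTerm_le (n k : ℕ) : scaleTerm ρ n k ≤ n * (1 / 2) ^ k := by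
  have h := eight_pow_le_cast hρ k
  have h1 : (4 : ℝ) ^ k ≤ √(jumpSize ρ k : ℝ) := by
    refine Real.le_sqrt_of_sq_le ?_
    simp only [jumpSize]
    push_cast
    calc ((4 : ℝ) ^ k) ^ 2 = 2 ^ k * 8 ^ k := by
          rw [← pow_mul, mul_comm k 2, pow_mul, ← mul_pow]; norm_num
      _ ≤ 2 ^ k * (2 * ρ k) := by
        gcongr
        linarith [scale_pos hρ k]
  calc scaleTerm ρ n k ≤ 2 ^ k * (n / 4 ^ k) := by
        unfold scaleTerm
        gcongr
        exact_mod_cast min_le_left _ _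
    _ = n * (1 / 2) ^ k := by
      rw [show (4 : ℝ) = 2 * 2 by norm_num, mul_pow, one_div_pow]; field_simp

theorem summable_scaleTerm (n : ℕ) : Summable (scaleTerm ρ n) :=
  Summable.of_nonneg_of_le (scaleTerm_nonneg n) (scaleTerm_le hρ n)
    (summable_geometric_two.mul_left _)

omit hρ in
theorem tsum_sq_le_sq_tsum (x : ℕ → ENNReal) : ∑' k, x k ^ 2 ≤ (∑' k, x k) ^ 2 := by
  rw [sq, ← ENNReal.tsum_mul_right]
  refine ENNReal.tsum_le_tsum fun k => ?_
  rw [sq]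
  gcongr
  exact ENNReal.le_tsum k

/-- Since $p_kv_k=4^k/v_k$, scale `k` contributes exactly the square of `scaleTerm ρ n k`. Bounding
the $\ell^2$ norm by the $\ell^1$ norm then lets the scales be treated separately. -/
theorem lintegral_jumpLaw_le (n : ℕ) :
    ∫⁻ m, (m.natAbs : ENNReal) * (min n m.natAbs : ℕ) ^ 2 ∂(jumpLaw (jumpProb ρ) (jumpSize ρ))
      ≤ ENNReal.ofReal (∑' k, scaleTerm ρ n k) ^ 2 := by
  rw [lintegral_jumpLaw_of_even _ _ _ fun m => by rw [Int.natAbs_neg],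
    ENNReal.ofReal_tsum_of_nonneg (scaleTerm_nonneg n) (summable_scaleTerm hρ n)]
  simp only [Int.natAbs_zero, Nat.cast_zero, zero_mul, mul_zero, zero_add, Int.natAbs_natCast]
  refine le_trans (le_of_eq (tsum_congr fun k => ?_)) (tsum_sq_le_sq_tsum _)
  have := scale_pos hρ k
  rw [← mul_assoc, jumpProb_mul_jumpSize hρ, ← ENNReal.ofReal_natCast,
    ← ENNReal.ofReal_pow (Nat.cast_nonneg _), ← ENNReal.ofReal_mul (by positivity),
    ← ENNReal.ofReal_pow (scaleTerm_nonneg n k)]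
  congr 1
  rw [scaleTerm, mul_pow, div_pow, Real.sq_sqrt (Nat.cast_nonneg _)]
  simp only [jumpSize]
  push_cast
  field_simp

theorem sum_mul_tsum_scaleTerm_le {a : ℕ → ℝ}
    (h : ∀ k N, ∑ n ∈ Finset.range N, a n * kernelWeight (jumpSize ρ k) n ≤ (1 / 4) ^ k) (N : ℕ) :
    ∑ n ∈ Finset.range N, a n * ((∑' k, scaleTerm ρ n k) / (n : ℝ) ^ (3 / 2 : ℝ)) ≤ 2 := by
  have hs : ∀ n ∈ Finset.range N,
      Summable fun k => a n * (scaleTerm ρ n k / (n : ℝ) ^ (3 / 2 : ℝ)) := fun n _ =>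
    ((summable_scaleTerm hρ n).div_const _).mul_left _
  simp_rw [← tsum_div_const, ← tsum_mul_left]
  rw [← Summable.tsum_finsetSum hs]
  refine le_of_le_of_eq ?_ tsum_geometric_two
  refine Summable.tsum_le_tsum (fun k => ?_) (summable_sum hs) summable_geometric_two
  calc ∑ n ∈ Finset.range N, a n * (scaleTerm ρ n k / (n : ℝ) ^ (3 / 2 : ℝ))
      = 2 ^ k * ∑ n ∈ Finset.range N, a n * kernelWeight (jumpSize ρ k) n := by
        rw [Finset.mul_sum]
        refine Finset.sum_congr rfl fun n _ => ?_
        unfold scaleTerm kernelWeight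
        ring
    _ ≤ 2 ^ k * (1 / 4) ^ k := by gcongr; exact h k N
    _ = (1 / 2) ^ k := by rw [← mul_pow]; norm_num

end Scales

/-! ### Failure of stochastic boundedness -/

theorem not_stochasticallyBounded {ρ : ℕ → ℕ} (hmono : StrictMono ρ) (hρ : ∀ k, 8 ^ k ≤ ρ k)
    [IsProbabilityMeasure (jumpLaw (jumpProb ρ) (jumpSize ρ))] :
    ¬ StationaryChain.StochasticallyBounded
      ((invariantLaw (jumpLaw (jumpProb ρ) (jumpSize ρ))).prod
        (seqLaw (jumpLaw (jumpProb ρ) (jumpSize ρ))))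
      (fun n ω => StationaryChain.partialSum (fun m : ℤ => (m.sign : ℝ)) chain n ω / √(n : ℝ)) := by
  intro hbdd
  set q := jumpLaw (jumpProb ρ) (jumpSize ρ) with hqdef
  have hZ : meanReturn q ≠ ⊤ := ((meanReturn_le hρ).trans_lt ENNReal.ofNat_lt_top).ne
  have := isProbabilityMeasure_invariantLaw q hZ
  -- Any level below the lower bound `1 / 32` would serve.
  obtain ⟨M, hM⟩ := hbdd (1 / 64) (by norm_num)
  obtain ⟨k, hk⟩ := pow_unbounded_of_one_lt M (one_lt_two (α := ℝ))
  have hpos := scale_pos hρ k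
  have hpos' : 0 < ρ k := by exact_mod_cast hpos
  have hjump : q {x | x.natAbs = jumpSize ρ k} = jumpProb ρ k :=
    jumpLaw_natAbs_eq (strictMono_jumpSize hmono) (by unfold jumpSize; positivity)
  have h2k : 2 ^ k ≤ ρ k := (Nat.pow_le_pow_left (by norm_num) k).trans (hρ k)
  -- With $n=(2\rho_k)^2$ the jump size is $2^k\sqrt n>M\sqrt n$. Loops started before $m=\rho_k^2$
  -- end by time `n` because $2^k\le\rho_k$.
  have h1 := le_measure_partialSum q (map_neg_jumpLaw _ _) (invariantLaw q)
    (isInvariant_invariantLaw q hZ) (v := jumpSize ρ k) (m := ρ k ^ 2) (n := (2 * ρ k) ^ 2)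
    (by unfold jumpSize; nlinarith)
  have hmp : ((ρ k ^ 2 : ℕ) : ENNReal) * jumpProb ρ k = ENNReal.ofReal (1 / 4) := by
    rw [jumpProb, ← ENNReal.ofReal_natCast, ← ENNReal.ofReal_mul (by positivity)]
    congr 1
    push_cast
    field_simp
    norm_num
  have hπ : ENNReal.ofReal (1 / 2) ≤ invariantLaw q {0} := by
    refine le_trans ?_ (invariantLaw_zero q)
    rw [one_div, ENNReal.ofReal_inv_of_pos two_pos, ENNReal.ofReal_ofNat]
    exact ENNReal.inv_le_inv.2 (meanReturn_le hρ)
  have hG : (invariantLaw q).prod (seqLaw q) {ω | ((jumpSize ρ k : ℕ) : ℝ) ≤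
      |StationaryChain.partialSum (fun m : ℤ => (m.sign : ℝ)) chain ((2 * ρ k) ^ 2) ω|}
      ≤ ENNReal.ofReal (1 / 64) := by
    refine (measure_mono fun ω hω => ?_).trans (hM ((2 * ρ k) ^ 2))
    have hsqrt : √(((2 * ρ k) ^ 2 : ℕ) : ℝ) = 2 * ρ k := by
      push_cast; exact Real.sqrt_sq (by positivity)
    rw [Set.mem_ofPred_eq] at hω ⊢
    simp only
    rw [hsqrt, abs_div, abs_of_pos (show (0 : ℝ) < 2 * ρ k by positivity),
      lt_div_iff₀ (by positivity)]
    refine lt_of_lt_of_le ?_ hω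
    simp only [jumpSize]
    push_cast
    gcongr
  rw [hjump, mul_left_comm, hmp] at h1
  -- Here $\pi\{0\}\ge1/2$ and $m\,p_k=1/4$, so the bound would give $1/8\le2/64+1/16=3/32$, which
  -- is false.
  have h2 : ENNReal.ofReal (1 / 8) ≤ ENNReal.ofReal (3 / 32) := by
    calc ENNReal.ofReal (1 / 8) = ENNReal.ofReal (1 / 2) * ENNReal.ofReal (1 / 4) := by
          rw [← ENNReal.ofReal_mul (by norm_num)]; norm_num
      _ ≤ invariantLaw q {0} * ENNReal.ofReal (1 / 4) := by gcongr
      _ ≤ _ := h1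
      _ ≤ 2 * ENNReal.ofReal (1 / 64) + ENNReal.ofReal (1 / 4) ^ 2 := by gcongr
      _ = ENNReal.ofReal (3 / 32) := by
        rw [← ENNReal.ofReal_pow (by norm_num), ← ENNReal.ofReal_ofNat 2,
          ← ENNReal.ofReal_mul (by norm_num), ← ENNReal.ofReal_add (by norm_num) (by norm_num)]
        norm_num
  rw [ENNReal.ofReal_le_ofReal_iff (by norm_num)] at h2
  norm_num at h2

end LoopChain

/-! ### The theorem -/

/-- The series is indexed by `n ≥ 1`: its term at `n = 0` is `0`, and `S₀ / √0 = 0` as well. -/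
theorem theorem1p2 (a : ℕ → ℝ) (ha_nonneg : ∀ n, 0 ≤ a n) (ha : Tendsto a atTop (𝓝 0)) :
    ∃ (Ω : Type) (_ : MeasurableSpace Ω) (μ : Measure Ω) (_ : IsProbabilityMeasure μ)
      (E : Type) (_ : Countable E) (mE : MeasurableSpace E) (_ : DiscreteMeasurableSpace E)
      (P : E → PMF E) (Y : ℕ → Ω → E) (g : E → ℝ),
      StationaryChain.IsMarkovChain P Y μ ∧
      StationaryChain.IsStationaryProcess Y μ ∧
      StationaryChain.IsErgodicProcess Y μ ∧
      StationaryChain.IsIrreducible P ∧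
      StationaryChain.IsAperiodic P ∧
      (∀ i, MemLp (fun ω => g (Y i ω)) 2 μ) ∧
      (∀ i, ∫ ω, g (Y i ω) ∂μ = 0) ∧
      Summable (fun n : ℕ => a n *
        (StationaryChain.l2Norm μ
          (μ[StationaryChain.partialSum g Y n | MeasurableSpace.comap (Y 0) mE])
          / (n : ℝ) ^ (3 / 2 : ℝ))) ∧
      ¬ StationaryChain.StochasticallyBounded μ
        (fun n ω => StationaryChain.partialSum g Y n ω / √(n : ℝ)) := by
  obtain ⟨ρ, hmono, hρ'⟩ := LoopChain.exists_scales ha_nonneg ha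
  have hρ := fun k => (hρ' k).1
  have hlt := LoopChain.tsum_jumpProb_lt_one hρ
  have hprob := LoopChain.isProbabilityMeasure_jumpLaw (LoopChain.jumpSize ρ) hlt.le
  set q := LoopChain.jumpLaw (LoopChain.jumpProb ρ) (LoopChain.jumpSize ρ) with hq
  have hZ : LoopChain.meanReturn q ≠ ⊤ :=
    ((LoopChain.meanReturn_le hρ).trans_lt ENNReal.ofNat_lt_top).ne
  have hsymm : q.map (fun m => -m) = q := LoopChain.map_neg_jumpLaw _ _
  have hπ := LoopChain.isProbabilityMeasure_invariantLaw q hZ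
  have hinv := LoopChain.isInvariant_invariantLaw q hZ
  have hspread : LoopChain.Spread q := LoopChain.spread_jumpLaw hlt
    (LoopChain.jumpProb_ne_zero hρ) (LoopChain.strictMono_jumpSize hmono)
  refine ⟨ℤ × (ℕ → ℤ), inferInstance, (LoopChain.invariantLaw q).prod (LoopChain.seqLaw q),
    inferInstance, ℤ, inferInstance, inferInstance, inferInstance, LoopChain.transition q,
    LoopChain.chain, fun m => (m.sign : ℝ), LoopChain.isMarkovChain _ q,
    LoopChain.isStationaryProcess _ q hinv, LoopChain.isErgodicProcess _ q hinv,
    LoopChain.isIrreducible q hspread, LoopChain.isAperiodic q hspread,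
    LoopChain.memLp_sign_chain _, LoopChain.integral_sign_chain_eq_zero q hsymm hZ, ?_,
    LoopChain.not_stochasticallyBounded hmono hρ⟩
  refine summable_of_sum_range_le (c := 2) (fun n => ?_) fun N => ?_
  · exact mul_nonneg (ha_nonneg n) (div_nonneg (Real.sqrt_nonneg _) (by positivity))
  · refine le_trans (Finset.sum_le_sum fun n _ => ?_)
      (LoopChain.sum_mul_tsum_scaleTerm_le hρ (fun k => (hρ' k).2) N)
    -- The two bounds compare squares in `ENNReal`; removing the square yields the real bound on the
    -- norm by the sum over scales.
    have h1 := (LoopChain.sq_l2Norm_condExp_le q hsymm hZ n).trans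
      (LoopChain.lintegral_jumpLaw_le hρ n)
    have h2 := (ENNReal.ofReal_le_ofReal_iff (tsum_nonneg (LoopChain.scaleTerm_nonneg n))).1
      ((ENNReal.pow_le_pow_left_iff two_ne_zero).1 h1)
    have := ha_nonneg n
    gcongr
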